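/- **Model.** A network is a finite simple undirected graph $G=(V,E)$ on $n$ vertices, not necessarily connected. Each vertex carries a unique $b$-bit identifier, and the edges at each vertex $v$ are numbered by ports $0,\dots,\deg(v)-1$ in an arbitrary order. In the deterministic $\mathsf{CONGEST}$ model with message size $B$, all vertices run the same deterministic program in synchronous rounds; in each round every vertex sends one message of at most $B$ bits through each of its ports, receives the messages of its neighbors and updates its state (local computation is unrestricted). Initially a vertex knows only its own identifier and degree, the length $b$ of the identifiers, and an upper bound $N\ge n$ on the number of vertices which is tight up to a polynomial. At the end each vertex outputs its own part of the solution. **Theorem.** For all constants $a\in\mathbb{R}$, $\beta>0$ and $c\in\mathbb{N}$ there are a constant $K$ and a deterministic $\mathsf{CONGEST}$ algorithm with message size $B=\lceil \beta\log_2 N\rceil=\Theta(\log n)$ such that the following holds for every graph $G$ on $n\ge 2$ vertices with unique $b$-bit identifiers, where $b\le a\log_2 n$ and $n\le N\le n^c$, and for every port numbering. The algorithm stops after at most $K\log_2^5 n$ rounds. It computes a network decomposition of $G$ with at most $K\log_2 n$ colors and weak diameter at most $K\log_2^2 n$: the vertices are partitioned into clusters, every vertex outputs the name of its cluster and the color of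 its cluster, adjacent clusters have different colors, and any two vertices of the same cluster are at distance at most $K\log_2^2 n$ in $G$. Moreover, for each cluster $\mathcal{C}$ it computes a Steiner tree $T_{\mathcal{C}}$, that is, a tree which is a subgraph of $G$ and contains all of $\mathcal{C}$, whose set of terminals is exactly $\mathcal{C}$ (its other vertices are nonterminals), and whose radius is at most $K\log_2^2 n$; each vertex outputs in which of these trees it lies and which of its incident edges belong to each of them. For every color, each vertex of $G$ lies in the Steiner trees of at most $K\log_2 n$ clusters of that color. -/

import Mathlib

namespace Congest

/-- A message of at most `B` bits. -/
abbrev Message (B : ℕ) : Type := {l : List Bool // l.length ≤ B}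

/-- A network on the vertex set `V`: an undirected graph in which every vertex carries a unique
`b`-bit identifier and numbers its incident edges by ports `0, …, deg v - 1` in an arbitrary way. -/
structure Network (V : Type) (b : ℕ) where
  graph : SimpleGraph V
  ident : V → BitVec b
  ident_injective : Function.Injective ident
  deg : V → ℕ
  port : ∀ v, Fin (deg v) ≃ graph.neighborSet v

namespace Network

variable {V : Type} {b : ℕ} (net : Network V b)

/-- The neighbor of `v` at the other end of the edge at port `i`. -/
def nbr (v : V) (i : Fin (net.deg v)) : V := (net.port v i : V)

theorem adj_nbr (v : V) (i : Fin (net.deg v)) : net.graph.Adj v (net.nbr v i) :=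
  (net.port v i).2

/-- The port under which the neighbor `net.nbr v i` of `v` sees the edge to `v`. -/
def backPort (v : V) (i : Fin (net.deg v)) : Fin (net.deg (net.nbr v i)) :=
  (net.port (net.nbr v i)).symm ⟨v, (net.adj_nbr v i).symm⟩

end Network

/-- What a vertex with `d` ports outputs. -/
structure NodeOutput (d : ℕ) where
  /-- The name of the cluster of the vertex. -/
  cluster : ℕ
  /-- The color of that cluster. -/
  color : ℕ
  /-- For each cluster name `k`: `none` if the vertex is not in the Steiner tree of the cluster
  named `k`, and otherwise the set of the ports at which there is an edge of that tree. -/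
  tree : ℕ → Option (Finset (Fin d))

/-- A deterministic synchronous message passing algorithm with `b`-bit identifiers and messages
of at most `B` bits that stops after a fixed number of rounds. All vertices execute the same
program; initially a vertex knows only its degree and its identifier. In each round it
sends one message through each port, receives one through each port and updates its state;
local computation is not restricted. The argument `d` is the degree of the vertex. -/
structure Algorithm (b B : ℕ) where
  State : Type
  init : (d : ℕ) → BitVec b → State
  send : (d : ℕ) → State → Fin d → Message B
  step : (d : ℕ) → State → (Fin d → Message B) → State
  rounds : ℕ
  output : (d : ℕ) → State → NodeOutput d

namespace Algorithm

variable {V : Type} {b B : ℕ}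

/-- The state of each vertex after `t` rounds on the network `net`. -/
def stateAfter (A : Algorithm b B) (net : Network V b) : ℕ → V → A.State
  | 0, v => A.init (net.deg v) (net.ident v)
  | t + 1, v => A.step (net.deg v) (A.stateAfter net t v) fun i =>
      A.send (net.deg (net.nbr v i)) (A.stateAfter net t (net.nbr v i)) (net.backPort v i)

/-- The output of each vertex at the end of the execution on the network `net`. -/
def result (A : Algorithm b B) (net : Network V b) (v : V) : NodeOutput (net.deg v) :=
  A.output (net.deg v) (A.stateAfter net A.rounds v)

end Algorithm

/-- The clusters `{v | cluster v = k}` with the colors `color` form a network decomposition of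
`G` with at most `C` colors (the numbers below `C`) and weak diameter at most `D`. -/
structure IsNetworkDecomposition {V : Type} (G : SimpleGraph V) (cluster color : V → ℕ)
    (C D : ℕ) : Prop where
  color_eq : ∀ u v, cluster u = cluster v → color u = color v
  color_lt : ∀ v, color v < C
  color_ne : ∀ u v, G.Adj u v → cluster u ≠ cluster v → color u ≠ color v
  weak_diam : ∀ u v, cluster u = cluster v → G.edist u v ≤ D

/-- `T` is a Steiner tree in `G` whose set of terminals is `S`: a tree that is a subgraph of `G`
and contains every vertex of `S`; its vertices outside `S` are the nonterminals. -/
structure IsSteinerTree {V : Type} {G : SimpleGraph V} (T : G.Subgraph) (S : Set V) : Prop where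
  isTree : T.coe.IsTree
  terminals_subset : S ⊆ T.verts

/-- The outputs `out` describe `T` as the tree of the cluster named `k`: each vertex knows whether
it is in `T`, and which of its incident edges are in `T`. -/
structure Describes {V : Type} {b : ℕ} (net : Network V b)
    (out : ∀ v, NodeOutput (net.deg v)) (k : ℕ) (T : net.graph.Subgraph) : Prop where
  mem_verts : ∀ v, v ∈ T.verts ↔ ((out v).tree k).isSome
  adj : ∀ v i, T.Adj v (net.nbr v i) ↔ ∃ s, (out v).tree k = some s ∧ i ∈ s

end Congest

/-! One color is built by a token-based ball growing process that leaves at most half of the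
unassigned vertices unassigned. Since identifiers are distinct, n ≤ 2^b, so b + 1 colors suffice.

The process starts with singleton clusters. A cluster has a level and tokens, initially level 0 and
one token. Its rank is twice its level, plus one if its identifier bit at that level is zero. A
living vertex proposes to an adjacent growing cluster of least rank if that rank is below its own. A
cluster holding at most 2Y tokens per proposer accepts and gains one token for each. Otherwise all
its proposers die, it pays Y tokens for each, and it stalls until the end of the phase of 2Y steps,
when it advances one level.

Four facts carry the analysis (`Cfg.Inv`, preserved by `Inv.step` and `Inv.endPhase`). Clusters of
adjacent living vertices agree on all bits below both levels. A move lowers the rank and a phase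
raises it by at most 3, so a vertex moves at most 3i + 1 times within i phases plus the current one.
Tokens are created only by starts and moves, so few deaths can be paid for. Finally, tok · 4^lev at
least doubles over every phase for a cluster that remains below level b: growing for a whole phase
doubles it, and stalling at most halves tok while the next level multiplies by 4. As tokens are
bounded, all clusters reach level b after O(b) phases (`Inv.lev_eq`), and adjacent living vertices
then lie in the same cluster.

Vertices remember their clusters at all times and the ports used for moving. Joining at time τ + 1
goes through a neighbor that was in the cluster at time τ. Hence broadcasts and sums over all
clusters run simultaneously: round τ serves exactly the joins at time τ + 1, and each vertex handles
one cluster per round (`runAll_bcast`, `runAll_ccast`). Overlap of the trees thus costs no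
additional factor. The edges of the first joins form Steiner trees of depth at most the number O(b²)
of steps, and the bound on moves bounds how many trees meet at a vertex. With O(b) colors, O(b²)
steps per color and O(b²) rounds per step, the total is O(b⁵), up to the constant factor for cutting
messages into chunks. -/

namespace Congest

/-! ### Round programs and the simulation of long messages by short ones -/

/-- One synchronous round of a program with local states `S` and messages in `α`. -/
structure Round (S α : Type) where
  send : (d : ℕ) → S → Fin d → α
  step : (d : ℕ) → S → (Fin d → α) → S

section Programs

variable {V S α : Type} {b B : ℕ}

/-- The effect of a round on the states of all vertices. -/
def Round.run (r : Round S α) (net : Network V b) (σ : V → S) : V → S := fun v =>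
  r.step (net.deg v) (σ v) fun i => r.send (net.deg (net.nbr v i)) (σ (net.nbr v i)) (net.backPort v i)

/-- The effect of a sequence of rounds on the states of all vertices. -/
def runAll (net : Network V b) (p : List (Round S α)) (σ : V → S) : V → S :=
  p.foldl (fun τ r => r.run net τ) σ

@[simp] theorem runAll_nil (net : Network V b) (σ : V → S) :
    runAll net ([] : List (Round S α)) σ = σ := rfl

@[simp] theorem runAll_cons (net : Network V b) (r : Round S α) (p : List (Round S α)) (σ : V → S) :
    runAll net (r :: p) σ = runAll net p (r.run net σ) := rfl

@[simp] theorem runAll_append (net : Network V b) (p q : List (Round S α)) (σ : V → S) :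
    runAll net (p ++ q) σ = runAll net q (runAll net p σ) := by
  simp [runAll, List.foldl_append]

/-- The algorithm that executes a fixed list of rounds. -/
def Algorithm.ofProgram (init : (d : ℕ) → BitVec b → S) (p : List (Round S (Message B)))
    (out : (d : ℕ) → S → NodeOutput d) : Algorithm b B where
  State := S × List (Round S (Message B))
  init d x := (init d x, p)
  send d s i := match s.2 with
    | [] => ⟨[], Nat.zero_le _⟩
    | r :: _ => r.send d s.1 i
  step d s m := match s.2 with
    | [] => s
    | r :: q => (r.step d s.1 m, q)
  rounds := p.length
  output d s := out d s.1

theorem Algorithm.ofProgram_stateAfter (net : Network V b) (init : (d : ℕ) → BitVec b → S)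
    (p : List (Round S (Message B))) (out : (d : ℕ) → S → NodeOutput d) (t : ℕ) (ht : t ≤ p.length) :
    (Algorithm.ofProgram init p out).stateAfter net t =
      fun v => (runAll net (p.take t) (fun v => init (net.deg v) (net.ident v)) v, p.drop t) := by
  induction t with
  | zero => rfl
  | succ t ih =>
    have ht' : t < p.length := ht
    funext v
    rw [Algorithm.stateAfter, ih ht'.le]
    simp only [Algorithm.ofProgram, List.drop_eq_getElem_cons ht', List.take_succ_eq_append_getElem ht',
      runAll_append, runAll_cons, runAll_nil]
    rfl

theorem Algorithm.ofProgram_result (net : Network V b) (init : (d : ℕ) → BitVec b → S)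
    (p : List (Round S (Message B))) (out : (d : ℕ) → S → NodeOutput d) (v : V) :
    (Algorithm.ofProgram init p out).result net v =
      out (net.deg v) (runAll net p (fun v => init (net.deg v) (net.ident v)) v) := by
  have h := Algorithm.ofProgram_stateAfter net init p out p.length le_rfl
  rw [List.take_length] at h
  rw [Algorithm.result, show (Algorithm.ofProgram init p out).rounds = p.length from rfl, h]
  rfl

/-- The round that transmits the `q`-th chunk of the messages of the round `r`. -/
def Round.chunk {k : ℕ} (enc : α → Fin k → Message B) (r : Round S α) (q : Fin k) :
    Round (S × (ℕ → Fin k → Message B)) (Message B) where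
  send d s i := enc (r.send d s.1 i) q
  step d s m := (s.1, fun i => if h : i < d then Function.update (s.2 i) q (m ⟨i, h⟩) else s.2 i)

/-- The round that evaluates the chunks received for the round `r`. -/
def Round.evalChunks {k : ℕ} (dec : (Fin k → Message B) → α) (r : Round S α) :
    Round (S × (ℕ → Fin k → Message B)) (Message B) where
  send _ _ _ := ⟨[], Nat.zero_le _⟩
  step d s _ := (r.step d s.1 fun i => dec (s.2 i), s.2)

/-- A round with messages in `α` as a sequence of rounds with messages of `B` bits. -/
def Round.split {k : ℕ} (enc : α → Fin k → Message B) (dec : (Fin k → Message B) → α)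
    (r : Round S α) : List (Round (S × (ℕ → Fin k → Message B)) (Message B)) :=
  (List.finRange k).map (r.chunk enc) ++ [r.evalChunks dec]

/-- The chunk rounds write only into the buffer and leave the simulated state alone. Therefore all
chunks come from the message determined by the same old state, although they are sent in different
rounds. -/
theorem Round.runAll_chunk {k : ℕ} (net : Network V b) (enc : α → Fin k → Message B)
    (r : Round S α) (l : List (Fin k)) (σ : V → S × (ℕ → Fin k → Message B)) (v : V) :
    (runAll net (l.map (r.chunk enc)) σ v).1 = (σ v).1 ∧
    ∀ (i : Fin (net.deg v)) (q : Fin k),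
      (runAll net (l.map (r.chunk enc)) σ v).2 i q =
        if q ∈ l then
          enc (r.send (net.deg (net.nbr v i)) (σ (net.nbr v i)).1 (net.backPort v i)) q
        else (σ v).2 i q := by
  induction l generalizing σ with
  | nil => simp
  | cons a l ih =>
    simp only [List.map_cons, runAll_cons]
    obtain ⟨h1, h2⟩ := ih ((r.chunk enc a).run net σ)
    refine ⟨h1, fun i q => ?_⟩
    rw [h2]
    by_cases hq : q ∈ l
    · simp [hq, Round.run, Round.chunk]
    · by_cases ha : q = a
      · subst ha
        simp [hq, Round.run, Round.chunk]
      · simp [hq, ha, Round.run, Round.chunk]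

theorem Round.runAll_split {k : ℕ} (net : Network V b) (enc : α → Fin k → Message B)
    (dec : (Fin k → Message B) → α) (hdec : ∀ x, dec (enc x) = x)
    (r : Round S α) (σ : V → S × (ℕ → Fin k → Message B)) :
    (fun v => (runAll net (r.split enc dec) σ v).1) = r.run net (fun v => (σ v).1) := by
  funext v
  obtain ⟨h1, h2⟩ := r.runAll_chunk net enc (List.finRange k) σ v
  simp only [List.mem_finRange, if_true] at h2
  rw [Round.split, runAll_append, runAll_cons, runAll_nil]
  simp only [Round.run, Round.evalChunks, h1]
  congr 1
  funext i
  rw [show (runAll net (List.map (r.chunk enc) (List.finRange k)) σ v).2 i = _ from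
    funext (h2 i), hdec]

theorem runAll_flatMap_split {k : ℕ} (net : Network V b) (enc : α → Fin k → Message B)
    (dec : (Fin k → Message B) → α) (hdec : ∀ x, dec (enc x) = x)
    (p : List (Round S α)) (σ : V → S × (ℕ → Fin k → Message B)) :
    (fun v => (runAll net (p.flatMap (Round.split enc dec)) σ v).1) =
      runAll net p (fun v => (σ v).1) := by
  induction p generalizing σ with
  | nil => rfl
  | cons r p ih =>
    rw [List.flatMap_cons, runAll_append, ih, runAll_cons, Round.runAll_split net enc dec hdec]

theorem exists_chunk_code [Fintype α] [Nonempty α] (k B : ℕ)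
    (h : Fintype.card α ≤ 2 ^ (k * B)) :
    ∃ (enc : α → Fin k → Message B) (dec : (Fin k → Message B) → α), ∀ x, dec (enc x) = x := by
  have hc : Fintype.card α ≤ Fintype.card (Fin k → Fin B → Bool) := by
    simpa [← pow_mul, mul_comm] using h
  obtain ⟨e⟩ := Function.Embedding.nonempty_of_card_le hc
  have hinj : Function.Injective
      (fun (x : α) (q : Fin k) => (⟨List.ofFn (e x q), by simp⟩ : Message B)) := by
    intro x y hxy
    apply e.injective
    funext q
    have := congrArg Subtype.val (congrFun hxy q)
    exact List.ofFn_injective this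
  exact ⟨_, Function.invFun _, Function.leftInverse_invFun hinj⟩

/-- A program whose messages have at most `k * B` bits can be executed with messages of `B` bits,
spending `k + 1` rounds on each of its rounds. -/
theorem exists_algorithm_of_program [Fintype α] [Nonempty α] {k : ℕ}
    (h : Fintype.card α ≤ 2 ^ (k * B)) (init : (d : ℕ) → BitVec b → S) (p : List (Round S α))
    (out : (d : ℕ) → S → NodeOutput d) :
    ∃ A : Algorithm b B, A.rounds = p.length * (k + 1) ∧
      ∀ (V : Type) (net : Network V b) (v : V), A.result net v =
        out (net.deg v) (runAll net p (fun v => init (net.deg v) (net.ident v)) v) := by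
  obtain ⟨enc, dec, hdec⟩ := exists_chunk_code (α := α) k B h
  refine ⟨Algorithm.ofProgram (S := S × (ℕ → Fin k → Message B))
    (fun d x => (init d x, fun _ _ => ⟨[], Nat.zero_le _⟩))
    (p.flatMap (Round.split enc dec)) (fun d s => out d s.1), ?_, ?_⟩
  · change (p.flatMap (Round.split enc dec)).length = _
    rw [List.length_flatMap]
    simp [Round.split]
  · intro V net v
    rw [Algorithm.ofProgram_result]
    have := congrFun (runAll_flatMap_split net enc dec hdec p
      (fun v => (init (net.deg v) (net.ident v), fun _ _ => ⟨[], Nat.zero_le _⟩))) v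
    exact congrArg (out (net.deg v)) this

end Programs

/-! ### The clustering process and its invariants -/

/-- A global configuration of the clustering process. Clusters are named by the vertices at which
they started. -/
@[ext] structure Cfg (V : Type) where
  alive : V → Bool
  cl : V → V
  lev : V → ℕ
  tok : V → ℕ
  stl : V → Bool
  mov : V → ℕ

/-- The rank of a cluster with identifier `x` at level `l`. Clusters grow at the expense of
clusters of larger rank. -/
def rankOf {b : ℕ} (x : BitVec b) (l : ℕ) : ℕ := 2 * l + if x.getLsbD l then 0 else 1

theorem rankOf_lt {b : ℕ} (x : BitVec b) {l : ℕ} (h : l ≤ b) : rankOf x l < 2 * b + 2 := by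
  unfold rankOf; split <;> omega

theorem two_mul_le_rankOf {b : ℕ} (x : BitVec b) (l : ℕ) : 2 * l ≤ rankOf x l := by
  unfold rankOf; omega

theorem rankOf_le {b : ℕ} (x : BitVec b) (l : ℕ) : rankOf x l ≤ 2 * l + 1 := by
  unfold rankOf; split <;> omega

/-- Ranks compare levels first and the bit at the common level second. -/
theorem le_of_rankOf_le {b : ℕ} {x y : BitVec b} {l m : ℕ} (h : rankOf x l ≤ rankOf y m) :
    l ≤ m := by
  have := two_mul_le_rankOf x l
  have := rankOf_le y m
  omega

namespace Cfg

variable {V : Type} {b : ℕ}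

/-- The rank of the cluster `C`. -/
def rank (ident : V → BitVec b) (c : Cfg V) (C : V) : ℕ := rankOf (ident C) (c.lev C)

/-- The proposals `tgt`: every living vertex proposes to a neighbor in a growing cluster
of least rank, if that rank is less than the rank of its own cluster. -/
structure IsProposal (G : SimpleGraph V) (ident : V → BitVec b) (c : Cfg V) (tgt : V → Option V) :
    Prop where
  alive_left : ∀ v u, tgt v = some u → c.alive v = true
  alive_right : ∀ v u, tgt v = some u → c.alive u = true
  adj : ∀ v u, tgt v = some u → G.Adj v u
  stl : ∀ v u, tgt v = some u → c.stl (c.cl u) = false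
  lt : ∀ v u, tgt v = some u → c.rank ident (c.cl u) < c.rank ident (c.cl v)
  le : ∀ v u, tgt v = some u → ∀ w, G.Adj v w → c.alive w = true → c.stl (c.cl w) = false →
    c.rank ident (c.cl u) ≤ c.rank ident (c.cl w)
  le_of_none : ∀ v, tgt v = none → c.alive v = true → ∀ w, G.Adj v w → c.alive w = true →
    c.stl (c.cl w) = false → c.rank ident (c.cl v) ≤ c.rank ident (c.cl w)

/-- The end of a phase: stalled clusters advance to the next level. -/
def endPhase (b : ℕ) (c : Cfg V) : Cfg V where
  alive := c.alive
  cl := c.cl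
  lev C := if c.stl C then min (c.lev C + 1) b else c.lev C
  tok := c.tok
  stl C := decide (b ≤ if c.stl C then min (c.lev C + 1) b else c.lev C)
  mov := c.mov

/-- The invariants of the clustering process started on the vertex set `A`, after `i` phases and
`s` steps of the next phase. -/
structure Inv (G : SimpleGraph V) (ident : V → BitVec b) (Y : ℕ) (A : Finset V) (i s : ℕ)
    (c : Cfg V) : Prop where
  alive_mem : ∀ v, c.alive v = true → v ∈ A
  cl_mem : ∀ v ∈ A, c.cl v ∈ A
  lev_le : ∀ C, c.lev C ≤ b
  lev_lt : ∀ C, c.stl C = false → c.lev C < b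
  agree : ∀ u v, G.Adj u v → c.alive u = true → c.alive v = true →
    ∀ k < c.lev (c.cl u), k < c.lev (c.cl v) →
      (ident (c.cl u)).getLsbD k = (ident (c.cl v)).getLsbD k
  stalled : ∀ u v, G.Adj u v → c.alive u = true → c.alive v = true → c.stl (c.cl u) = true →
    c.rank ident (c.cl v) ≤ c.rank ident (c.cl u)
  mov_le : ∀ v, c.mov v + c.rank ident (c.cl v) ≤ 3 * i + 1
  tokens : ∑ C ∈ A, c.tok C + Y * (A.filter fun v => c.alive v = false).card ≤
    A.card + ∑ v ∈ A, c.mov v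
  growing : ∀ C, c.stl C = false → (2 * Y + s) * 2 ^ i ≤ 2 * Y * (c.tok C * 4 ^ c.lev C)
  resting : ∀ C, c.lev C < b → c.stl C = true → 2 ^ i ≤ 2 * (c.tok C * 4 ^ c.lev C)

theorem Inv.mov_lt {G : SimpleGraph V} {ident : V → BitVec b} {c : Cfg V} {Y : ℕ} {A : Finset V}
    {i s : ℕ} (hi : Inv G ident Y A i s c) (v : V) : c.mov v ≤ 3 * i + 1 := by
  have := hi.mov_le v
  omega

section InvLemmas

variable {G : SimpleGraph V} {ident : V → BitVec b} {c : Cfg V} {Y : ℕ}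

/-- For the agreement of bits, a new bit k matters only if a cluster stalled at level k advances.
Its neighbors have no larger rank, so if bit k is below both new levels, both clusters were stalled
at level k with equal rank, that is, with equal bit k. For the tokens, 2Y steps of growth double tok
· 4^lev, while a stalled cluster makes up for its lost half by the factor 4 of the new level. -/
theorem Inv.endPhase {A : Finset V} {i : ℕ} (hY : 0 < Y) (hi : Inv G ident Y A i (2 * Y) c) :
    Inv G ident Y A (i + 1) 0 (c.endPhase b) where
  alive_mem := hi.alive_mem
  cl_mem := hi.cl_mem
  lev_le C := by
    have := hi.lev_le C
    simp only [Cfg.endPhase]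
    split <;> omega
  lev_lt C hC := by simpa [Cfg.endPhase] using hC
  agree u v huv hu hv k hku hkv := by
    change c.alive u = true at hu
    change c.alive v = true at hv
    change (ident (c.cl u)).getLsbD k = (ident (c.cl v)).getLsbD k
    have h0 := hi.agree u v huv hu hv k
    have hsu := hi.stalled u v huv hu hv
    have hsv := hi.stalled v u huv.symm hv hu
    have hlu := hi.lev_le (c.cl u)
    have hlv := hi.lev_le (c.cl v)
    simp only [Cfg.endPhase] at hku hkv
    by_cases h1 : k < c.lev (c.cl u)
    · by_cases h2 : k < c.lev (c.cl v)
      · exact h0 h1 h2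
      · have hs : c.stl (c.cl v) = true := by
          by_contra hs
          rw [if_neg hs] at hkv
          omega
        have := le_of_rankOf_le (hsv hs)
        omega
    · have hs : c.stl (c.cl u) = true := by
        by_contra hs
        rw [if_neg hs] at hku
        omega
      have h3 := le_of_rankOf_le (hsu hs)
      rw [if_pos hs] at hku
      have hs' : c.stl (c.cl v) = true := by
        by_contra hs
        rw [if_neg hs] at hkv
        omega
      have h4 := le_of_rankOf_le (hsv hs')
      -- Both clusters are stalled, so each rank bounds the other; at the common level k equal ranks
      -- mean equal bits.
      have h5 := le_antisymm (hsu hs) (hsv hs')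
      have e1 : c.lev (c.cl u) = k := by omega
      have e2 : c.lev (c.cl v) = k := by omega
      simp only [rank, rankOf, e1, e2] at h5
      cases ha : (ident (c.cl u)).getLsbD k <;> cases hb : (ident (c.cl v)).getLsbD k <;>
        simp_all
  stalled u v huv hu hv hs := by
    -- Only clusters at the last level remain stalled in the new phase. There is no bit b, so their
    -- rank is 2b + 1, the maximum.
    have e : (c.endPhase b).lev (c.cl u) = b := by
      have := hi.lev_le (c.cl u)
      simp only [Cfg.endPhase, decide_eq_true_eq] at hs ⊢
      split at hs
      · rw [if_pos ‹_›]; omega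
      · rw [if_neg ‹_›]; omega
    have hl : (c.endPhase b).lev (c.cl v) ≤ b := by
      have := hi.lev_le (c.cl v)
      simp only [Cfg.endPhase]
      split <;> omega
    change rankOf (ident (c.cl v)) ((c.endPhase b).lev (c.cl v)) ≤
      rankOf (ident (c.cl u)) ((c.endPhase b).lev (c.cl u))
    have := rankOf_lt (ident (c.cl v)) hl
    rw [e]
    simp only [rankOf, BitVec.getLsbD_of_ge _ _ le_rfl, Bool.false_eq_true, if_false] at this ⊢
    omega
  -- Advancing takes the rank from at least 2l to at most 2(l + 1) + 1, which explains the slope 3.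
  mov_le v := by
    have h0 := hi.mov_le v
    have h1 := two_mul_le_rankOf (ident (c.cl v)) (c.lev (c.cl v))
    have h2 := rankOf_le (ident (c.cl v)) ((c.endPhase b).lev (c.cl v))
    have h3 : (c.endPhase b).lev (c.cl v) ≤ c.lev (c.cl v) + 1 := by
      simp only [Cfg.endPhase]
      split <;> omega
    change c.mov v + rankOf (ident (c.cl v)) ((c.endPhase b).lev (c.cl v)) ≤ _
    simp only [rank] at h0
    omega
  tokens := hi.tokens
  growing C hC := by
    have hC : (c.endPhase b).lev C < b := by simpa [Cfg.endPhase] using hC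
    change _ ≤ 2 * Y * (c.tok C * 4 ^ ((c.endPhase b).lev C))
    rw [add_zero]
    refine Nat.mul_le_mul_left _ ?_
    by_cases hs : c.stl C = true
    · have e : (c.endPhase b).lev C = c.lev C + 1 := by
        simp only [Cfg.endPhase, hs, if_true] at hC ⊢
        omega
      have := hi.resting C (by omega) hs
      rw [e, pow_succ, pow_succ, ← mul_assoc]
      omega
    · have e : (c.endPhase b).lev C = c.lev C := by simp [Cfg.endPhase, hs]
      have h0 := hi.growing C (by simpa using hs)
      rw [e]
      refine Nat.le_of_mul_le_mul_left (c := 2 * Y) (le_trans (le_of_eq ?_) h0) (by omega)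
      ring
  resting C hl hC := by
    simp only [Cfg.endPhase, decide_eq_true_eq] at hl hC
    omega

/-- Each vertex accounts for its initial token and one token per move, at most 3i + 2 altogether. -/
theorem Inv.token_bound {A : Finset V} {i s : ℕ} (hi : Inv G ident Y A i s c) :
    ∑ C ∈ A, c.tok C + Y * (A.filter fun v => c.alive v = false).card ≤ A.card * (3 * i + 2) := by
  refine hi.tokens.trans ?_
  have : ∑ v ∈ A, c.mov v ≤ A.card * (3 * i + 1) := by
    simpa using Finset.sum_le_card_nsmul A _ _ fun v _ => hi.mov_lt v
  linarith [this]

/-- With price Y = 2(3i + 2), the deaths of more than half of the vertices would cost more than all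
tokens ever created. -/
theorem Inv.two_mul_card_dead_le {A : Finset V} {i s : ℕ}
    (hi : Inv G ident (2 * (3 * i + 2)) A i s c) :
    2 * (A.filter fun v => c.alive v = false).card ≤ A.card := by
  have h := hi.token_bound
  refine Nat.le_of_mul_le_mul_left (c := 3 * i + 2) ?_ (by omega)
  nlinarith [h, Nat.zero_le (∑ C ∈ A, c.tok C)]

theorem phase_count_bound (b : ℕ) : 24 * b + 28 < 2 ^ (b + 6) := by
  induction b with
  | zero => norm_num
  | succ b ih => rw [show b + 1 + 6 = (b + 6) + 1 by ring, pow_succ]; omega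

/-- After sufficiently many phases every cluster has reached the last level. -/
theorem Inv.lev_eq {A : Finset V} (hA : A.card ≤ 2 ^ b)
    (hi : Inv G ident Y A (4 * b + 4) 0 c) (hY : 0 < Y) {C : V} (hC : C ∈ A) : c.lev C = b := by
  refine le_antisymm (hi.lev_le C) (not_lt.1 fun hlt => ?_)
  have h1 : 2 ^ (4 * b + 4) ≤ 2 * (c.tok C * 4 ^ c.lev C) := by
    cases hs : c.stl C with
    | true => exact hi.resting C hlt hs
    | false =>
      have := hi.growing C hs
      rw [add_zero] at this
      have := Nat.le_of_mul_le_mul_left this (by omega)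
      omega
  have h2 : c.tok C ≤ 2 ^ b * (12 * b + 14) := by
    have h3 := hi.token_bound
    have h4 : c.tok C ≤ ∑ C ∈ A, c.tok C := Finset.single_le_sum (f := c.tok) (by simp) hC
    have h5 : A.card * (3 * (4 * b + 4) + 2) ≤ 2 ^ b * (12 * b + 14) :=
      Nat.mul_le_mul hA (by omega)
    have := Nat.zero_le (Y * (A.filter fun v => c.alive v = false).card)
    omega
  -- A level below b is at most e. Writing the lower bound on the tokens as 2^(3e+1) · 2^(e+7) and
  -- the upper one as 2^(3e+1) · 2(12b + 14) reduces the contradiction to `phase_count_bound`.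
  obtain ⟨e, rfl⟩ : ∃ e, b = e + 1 := ⟨b - 1, by omega⟩
  have h6 : 4 ^ c.lev C ≤ 4 ^ e := Nat.pow_le_pow_right (by norm_num) (by omega)
  have h7 : 4 ^ e = 2 ^ (2 * e) := by rw [pow_mul]; norm_num
  have h8 : 2 ^ (4 * (e + 1) + 4) ≤ 2 * (2 ^ (e + 1) * (12 * (e + 1) + 14) * 2 ^ (2 * e)) :=
    h1.trans (Nat.mul_le_mul_left 2 (Nat.mul_le_mul h2 (h7 ▸ h6)))
  have h9 : 2 ^ (4 * (e + 1) + 4) = 2 ^ (3 * e + 1) * 2 ^ (e + 1 + 6) := by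
    rw [← pow_add]; congr 1; ring
  have h10 : 2 * (2 ^ (e + 1) * (12 * (e + 1) + 14) * 2 ^ (2 * e)) =
      2 ^ (3 * e + 1) * (2 * (12 * (e + 1) + 14)) := by
    rw [show 3 * e + 1 = (e + 1) + 2 * e by ring, pow_add]
    ring
  rw [h9, h10] at h8
  have h11 := Nat.le_of_mul_le_mul_left h8 (by positivity)
  have := phase_count_bound (e + 1)
  omega

end InvLemmas

variable [Fintype V] [DecidableEq V]

/-- The set of vertices that propose to join the cluster `C`. -/
def proposers (c : Cfg V) (tgt : V → Option V) (C : V) : Finset V :=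
  Finset.univ.filter fun v => (tgt v).map c.cl = some C

/-- Whether the cluster `C` accepts the proposals. -/
def accepts (Y : ℕ) (c : Cfg V) (tgt : V → Option V) (C : V) : Bool :=
  decide (c.tok C ≤ 2 * Y * (c.proposers tgt C).card)

/-- One growth step. -/
def step (Y : ℕ) (c : Cfg V) (tgt : V → Option V) : Cfg V where
  alive v := match tgt v with
    | none => c.alive v
    | some u => c.alive v && c.accepts Y tgt (c.cl u)
  cl v := match tgt v with
    | none => c.cl v
    | some u => if c.accepts Y tgt (c.cl u) then c.cl u else c.cl v
  lev := c.lev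
  tok C := if c.stl C then c.tok C else
    if c.accepts Y tgt C then c.tok C + (c.proposers tgt C).card
    else c.tok C - Y * (c.proposers tgt C).card
  stl C := c.stl C || !c.accepts Y tgt C
  mov v := match tgt v with
    | none => c.mov v
    | some u => if c.accepts Y tgt (c.cl u) then c.mov v + 1 else c.mov v

/-- Double counting of proposals by target cluster and by proposer. It matches the tokens gained and
paid by clusters with the moves and deaths of vertices. -/
theorem sum_mul_proposers {c : Cfg V} {tgt : V → Option V} {A : Finset V}
    (hA : ∀ v u, tgt v = some u → v ∈ A ∧ c.cl u ∈ A) (f : V → ℕ) :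
    ∑ C ∈ A, f C * (c.proposers tgt C).card = ∑ v ∈ A, ((tgt v).map fun u => f (c.cl u)).getD 0 := by
  have h1 : ∀ C, (c.proposers tgt C).card =
      ∑ v ∈ A, if (tgt v).map c.cl = some C then 1 else 0 := by
    intro C
    rw [← Finset.card_filter]
    congr 1
    ext v
    simp only [proposers, Finset.mem_filter, Finset.mem_univ, true_and]
    refine ⟨fun h => ⟨?_, h⟩, fun h => h.2⟩
    rw [Option.map_eq_some_iff] at h
    obtain ⟨u, hu, -⟩ := h
    exact (hA v u hu).1
  simp only [h1, Finset.mul_sum]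
  rw [Finset.sum_comm]
  refine Finset.sum_congr rfl fun v hv => ?_
  cases h : tgt v with
  | none => simp
  | some u =>
    have := (hA v u h).2
    simp [this]

section StepLemmas

variable {G : SimpleGraph V} {ident : V → BitVec b} {c : Cfg V} {tgt : V → Option V} {Y : ℕ}

theorem IsProposal.step_of_alive (h : IsProposal G ident c tgt) {v : V}
    (hv : (c.step Y tgt).alive v = true) :
    c.alive v = true ∧ ((tgt v = none ∧ (c.step Y tgt).cl v = c.cl v) ∨
      ∃ u, tgt v = some u ∧ c.accepts Y tgt (c.cl u) = true ∧ (c.step Y tgt).cl v = c.cl u) := by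
  cases ht : tgt v with
  | none => simp_all [step]
  | some u =>
    have := h.alive_left v u ht
    simp_all [step]

theorem IsProposal.rank_step_le (h : IsProposal G ident c tgt) (v : V) :
    (c.step Y tgt).rank ident ((c.step Y tgt).cl v) ≤ c.rank ident (c.cl v) := by
  change c.rank ident ((c.step Y tgt).cl v) ≤ _
  cases ht : tgt v with
  | none => simp [step, ht]
  | some u =>
    have := h.lt v u ht
    by_cases ha : c.accepts Y tgt (c.cl u) = true <;> simp [step, ht, ha, this.le]

theorem IsProposal.proposers_of_stl (h : IsProposal G ident c tgt) {C : V} (hC : c.stl C = true) :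
    (c.proposers tgt C).card = 0 := by
  rw [Finset.card_eq_zero, proposers, Finset.filter_eq_empty_iff]
  intro v _ hv
  rw [Option.map_eq_some_iff] at hv
  obtain ⟨u, hu, rfl⟩ := hv
  simp [h.stl v u hu] at hC

/-- Moves go to adjacent clusters of smaller rank: this preserves agreement and pays for the move
count. A cluster that stalls now was available to all its neighbors in this step, so every surviving
neighbor ends up with a rank no larger. Acceptance needs at least tok / (2Y) proposers, hence adds
at least a fraction 1 / (2Y) to the tokens; rejection costs less than half of them. -/
theorem Inv.step {A : Finset V} {i s : ℕ} (hY : 0 < Y) (hi : Inv G ident Y A i s c)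
    (h : IsProposal G ident c tgt) : Inv G ident Y A i (s + 1) (c.step Y tgt) where
  alive_mem v hv := hi.alive_mem v (h.step_of_alive hv).1
  cl_mem v hv := by
    cases ht : tgt v with
    | none => simpa [Cfg.step, ht] using hi.cl_mem v hv
    | some u =>
      have h1 := hi.cl_mem v hv
      have h2 := hi.cl_mem u (hi.alive_mem u (h.alive_right v u ht))
      by_cases ha : c.accepts Y tgt (c.cl u) = true <;> simp [Cfg.step, ht, ha, h1, h2]
  lev_le := hi.lev_le
  lev_lt C hC := hi.lev_lt C (by simp_all [Cfg.step])
  agree u v huv hu hv k hku hkv := by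
    obtain ⟨hu1, hu2⟩ := h.step_of_alive hu
    obtain ⟨hv1, hv2⟩ := h.step_of_alive hv
    change k < c.lev _ at hku hkv
    -- A mover was adjacent to its new cluster, whose level is no higher than that of the old one.
    -- The two clusters therefore agree on all bits below the new level, and the bits visible at the
    -- mover do not change.
    have key : ∀ w, c.alive w = true → ((tgt w = none ∧ (c.step Y tgt).cl w = c.cl w) ∨
        ∃ u, tgt w = some u ∧ c.accepts Y tgt (c.cl u) = true ∧ (c.step Y tgt).cl w = c.cl u) →
        k < c.lev ((c.step Y tgt).cl w) → k < c.lev (c.cl w) ∧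
        (ident ((c.step Y tgt).cl w)).getLsbD k = (ident (c.cl w)).getLsbD k := by
      rintro w hw (⟨-, e⟩ | ⟨x, hx, -, e⟩) hk
      · rw [e] at hk ⊢
        exact ⟨hk, rfl⟩
      · rw [e] at hk ⊢
        have hlt : k < c.lev (c.cl w) := lt_of_lt_of_le hk (le_of_rankOf_le (h.lt w x hx).le)
        exact ⟨hlt, (hi.agree w x (h.adj w x hx) hw (h.alive_right w x hx) k hlt hk).symm⟩
    obtain ⟨a1, a2⟩ := key u hu1 hu2 hku
    obtain ⟨b1, b2⟩ := key v hv1 hv2 hkv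
    rw [a2, b2]
    exact hi.agree u v huv hu1 hv1 k a1 b1
  stalled u v huv hu hv hs := by
    obtain ⟨hu1, hu2⟩ := h.step_of_alive hu
    obtain ⟨hv1, hv2⟩ := h.step_of_alive hv
    -- An accepting cluster keeps growing, so a member of a stalled cluster cannot have joined it in
    -- this step.
    have hcl : (c.step Y tgt).cl u = c.cl u := by
      rcases hu2 with ⟨-, e⟩ | ⟨x, hx, hacc, e⟩
      · exact e
      · rw [e] at hs
        have := h.stl u x hx
        simp [Cfg.step, this, hacc] at hs
    rw [hcl] at hs ⊢
    by_cases hold : c.stl (c.cl u) = true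
    · exact (h.rank_step_le v).trans (hi.stalled u v huv hu1 hv1 hold)
    · have hold : c.stl (c.cl u) = false := by simpa using hold
      change c.rank ident _ ≤ c.rank ident _
      rcases hv2 with ⟨hn, e⟩ | ⟨x, hx, -, e⟩
      · rw [e]
        exact h.le_of_none v hn hv1 u huv.symm hu1 hold
      · rw [e]
        exact h.le v x hx u huv.symm hu1 hold
  mov_le v := by
    have h0 := hi.mov_le v
    change (c.step Y tgt).mov v + c.rank ident _ ≤ _
    cases ht : tgt v with
    | none => simpa [Cfg.step, ht] using h0
    | some u =>
      have h1 := h.lt v u ht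
      by_cases ha : c.accepts Y tgt (c.cl u) = true
      · simp only [Cfg.step, ht, ha, if_true]; omega
      · simpa [Cfg.step, ht, ha] using h0
  tokens := by
    have hA : ∀ v u, tgt v = some u → v ∈ A ∧ c.cl u ∈ A := fun v u e =>
      ⟨hi.alive_mem v (h.alive_left v u e), hi.cl_mem u (hi.alive_mem u (h.alive_right v u e))⟩
    have e1 := sum_mul_proposers hA (fun C => if c.accepts Y tgt C then 1 else 0)
    have e2 := sum_mul_proposers hA (fun C => if c.accepts Y tgt C then 0 else 1)
    have e3 : ∑ v ∈ A, (c.step Y tgt).mov v = ∑ v ∈ A, c.mov v +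
        ∑ v ∈ A, ((tgt v).map fun u => if c.accepts Y tgt (c.cl u) then 1 else 0).getD 0 := by
      rw [← Finset.sum_add_distrib]
      refine Finset.sum_congr rfl fun v _ => ?_
      cases ht : tgt v with
      | none => simp [Cfg.step, ht]
      | some u => by_cases ha : c.accepts Y tgt (c.cl u) = true <;> simp [Cfg.step, ht, ha]
    have e4 : (A.filter fun v => (c.step Y tgt).alive v = false).card =
        (A.filter fun v => c.alive v = false).card +
        ∑ v ∈ A, ((tgt v).map fun u => if c.accepts Y tgt (c.cl u) then 0 else 1).getD 0 := by
      rw [Finset.card_filter, Finset.card_filter, ← Finset.sum_add_distrib]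
      refine Finset.sum_congr rfl fun v _ => ?_
      cases ht : tgt v with
      | none => simp [Cfg.step, ht]
      | some u =>
        have := h.alive_left v u ht
        by_cases ha : c.accepts Y tgt (c.cl u) = true <;> simp [Cfg.step, ht, ha, this]
    have e5 : ∑ C ∈ A, (c.step Y tgt).tok C +
        Y * ∑ C ∈ A, (if c.accepts Y tgt C then 0 else 1) * (c.proposers tgt C).card =
        ∑ C ∈ A, c.tok C +
          ∑ C ∈ A, (if c.accepts Y tgt C then 1 else 0) * (c.proposers tgt C).card := by
      rw [Finset.mul_sum, ← Finset.sum_add_distrib, ← Finset.sum_add_distrib]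
      refine Finset.sum_congr rfl fun C _ => ?_
      by_cases hs : c.stl C = true
      · simp [Cfg.step, hs, h.proposers_of_stl hs]
      · by_cases ha : c.accepts Y tgt C = true
        · simp [Cfg.step, hs, ha]
        -- Rejection guarantees that the truncated subtraction of Y times the number of proposers is
        -- exact.
        · have hlt : 2 * Y * (c.proposers tgt C).card < c.tok C := by
            simpa [accepts] using ha
          simp only [Cfg.step, hs, ha, if_false, Bool.false_eq_true]
          rw [mul_assoc] at hlt
          rw [one_mul, zero_mul]
          omega
    have := hi.tokens
    rw [e3, e4, mul_add, ← e1, ← e2]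
    omega
  growing C hC := by
    have hs : c.stl C = false := by simp_all [Cfg.step]
    have ha : c.accepts Y tgt C = true := by simp_all [Cfg.step]
    have h0 := hi.growing C hs
    have hp : c.tok C ≤ 2 * Y * (c.proposers tgt C).card := by simpa [accepts] using ha
    -- The increment per step is measured against 2^i, the value guaranteed at the start of the
    -- phase; growth that is linear in s is enough.
    have h1 : 2 ^ i ≤ c.tok C * 4 ^ c.lev C := by
      refine Nat.le_of_mul_le_mul_left (c := 2 * Y) ?_ (by omega)
      refine le_trans (Nat.mul_le_mul_right _ (Nat.le_add_right _ s)) h0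
    simp only [Cfg.step, hs, ha, if_true, Bool.false_eq_true, if_false]
    calc (2 * Y + (s + 1)) * 2 ^ i = (2 * Y + s) * 2 ^ i + 2 ^ i := by ring
      _ ≤ 2 * Y * (c.tok C * 4 ^ c.lev C) + 2 * Y * (c.proposers tgt C).card * 4 ^ c.lev C :=
          add_le_add h0 (h1.trans (Nat.mul_le_mul_right _ hp))
      _ = _ := by ring
  resting C hl hC := by
    change c.lev C < b at hl
    by_cases hs : c.stl C = true
    · simpa [Cfg.step, hs] using hi.resting C hl hs
    · have hs : c.stl C = false := by simpa using hs
      have ha : c.accepts Y tgt C = false := by simp_all [Cfg.step]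
      have h0 := hi.growing C hs
      have hp : 2 * Y * (c.proposers tgt C).card < c.tok C := by simpa [accepts] using ha
      have h1 : 2 ^ i ≤ c.tok C * 4 ^ c.lev C := by
        refine Nat.le_of_mul_le_mul_left (c := 2 * Y) ?_ (by omega)
        refine le_trans (Nat.mul_le_mul_right _ (Nat.le_add_right _ s)) h0
      simp only [Cfg.step, hs, ha, Bool.false_eq_true, if_false]
      rw [mul_assoc] at hp
      refine h1.trans ?_
      rw [← mul_assoc]
      exact Nat.mul_le_mul_right _ (by omega)

end StepLemmas

end Cfg
-- The distributed program for one step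
/-- The messages of the clustering program: an identifier, a rank, a flag and a counter. -/
abbrev Msg (b : ℕ) : Type := BitVec b × Fin (2 * b + 2) × Bool × ZMod (2 ^ (b + 1))

/-- The local state of a vertex in the clustering program. -/
structure St (b : ℕ) where
  id : BitVec b
  alive : Bool
  /-- The cluster of the vertex after each step. -/
  cl : ℕ → BitVec b
  /-- The port through which the vertex joined its cluster in the step that ends at this time. -/
  pt : ℕ → Option ℕ
  lev : ℕ
  tok : ℕ
  stl : Bool
  acc : BitVec b → ZMod (2 ^ (b + 1))
  know : BitVec b → Fin (2 * b + 2) × Bool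
  /-- The color and the cluster that the vertex outputs, once they are determined. -/
  out : Option (ℕ × BitVec b)
  /-- For each color and cluster, the ports at which there are edges of its Steiner tree. -/
  tr : ℕ → BitVec b → Option (Finset ℕ)

/-- A port number as a port of a vertex of degree `d`. -/
def finPort (d : ℕ) (o : Option ℕ) : Option (Fin d) :=
  o.bind fun i => if h : i < d then some ⟨i, h⟩ else none

@[simp] theorem finPort_map {d : ℕ} (o : Option (Fin d)) : finPort d (o.map Fin.val) = o := by
  cases o <;> simp [finPort]

@[simp] theorem finPort_val {d : ℕ} (i : Fin d) : finPort d (some (i : ℕ)) = some i := by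
  simp [finPort]

@[simp] theorem finPort_none {d : ℕ} : finPort d none = none := rfl

/-- A round without communication. -/
def localRound {b : ℕ} (f : ℕ → St b → St b) : Round (St b) (Msg b) where
  send _ _ _ := (0, 0, false, 0)
  step d s _ := f d s

/-- Information about the clusters is passed to the vertices that joined at time `τ + 1`. -/
def bcastRound {b : ℕ} (τ : ℕ) : Round (St b) (Msg b) where
  send _ s _ := (0, (s.know (s.cl τ)).1, (s.know (s.cl τ)).2, 0)
  step d s m :=
    { s with
      know := match finPort d (s.pt (τ + 1)) with
        | none => s.know
        | some i => Function.update s.know (s.cl (τ + 1)) ((m i).2.1, (m i).2.2.1) }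

/-- Every vertex that joined a cluster at time `τ + 1` passes its counter for that cluster on
to the neighbor through which it joined. -/
def ccastRound {b : ℕ} (τ : ℕ) : Round (St b) (Msg b) where
  send d s i := (0, 0, false, if finPort d (s.pt (τ + 1)) = some i then s.acc (s.cl (τ + 1)) else 0)
  step d s m :=
    { s with
      acc := fun C =>
        (if (finPort d (s.pt (τ + 1))).isSome ∧ C = s.cl (τ + 1) then 0 else s.acc C) +
          if C = s.cl τ then ∑ i, (m i).2.2.2 else 0 }

/-- Going forward in time, the parent of a vertex joining at τ + 1 is informed before round τ. In
`ccast` the order is reversed, so that counters flow back to the time-0 member, the root. -/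
def bcast {b : ℕ} (t : ℕ) : List (Round (St b) (Msg b)) := (List.range t).map bcastRound

def ccast {b : ℕ} (t : ℕ) : List (Round (St b) (Msg b)) := ((List.range t).map ccastRound).reverse

open Classical in
/-- A port to a growing cluster of least rank, provided that this rank is less than `r`. -/
noncomputable def bestPort {b d : ℕ} (r : Fin (2 * b + 2)) (m : Fin d → Msg b) : Option (Fin d) :=
  if h : ∃ i, (m i).2.2.1 = true ∧ (m i).2.1 < r ∧ ∀ j, (m j).2.2.1 = true → (m i).2.1 ≤ (m j).2.1
  then some h.choose else none

/-- Neighbors exchange the states of their clusters, and every living vertex makes its proposal.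
The proposal is recorded as a tentative move. -/
noncomputable def proposeRound {b : ℕ} (t : ℕ) : Round (St b) (Msg b) where
  send _ s _ := (s.cl t, (s.know (s.cl t)).1, s.alive && !(s.know (s.cl t)).2, 0)
  step _ s m :=
    let o := if s.alive then bestPort (s.know (s.cl t)).1 m else none
    { s with
      cl := Function.update s.cl (t + 1) ((o.map fun i => (m i).1).getD (s.cl t))
      pt := Function.update s.pt (t + 1) (o.map Fin.val)
      acc := fun C => if o.map (fun i => (m i).1) = some C then 1 else 0 }

def St.announce {b : ℕ} (s : St b) : St b :=
  { s with know := Function.update s.know s.id (Fin.ofNat (2 * b + 2) (rankOf s.id s.lev), s.stl) }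

/-- The root of a cluster decides about the proposals. -/
def St.decide {b : ℕ} (Y : ℕ) (s : St b) : St b :=
  let p := (s.acc s.id).val
  let a := Decidable.decide (s.tok ≤ 2 * Y * p)
  { s with
    tok := if s.stl then s.tok else if a then s.tok + p else s.tok - Y * p
    stl := s.stl || !a
    know := Function.update s.know s.id (0, a) }

/-- A vertex whose proposal was rejected dies. -/
def St.conclude {b : ℕ} (t d : ℕ) (s : St b) : St b :=
  if (finPort d (s.pt (t + 1))).isSome && !(s.know (s.cl (t + 1))).2 then
    { s with
      alive := false
      cl := Function.update s.cl (t + 1) (s.cl t)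
      pt := Function.update s.pt (t + 1) none }
  else s

/-- The program of the step that leads from time `t` to time `t + 1`. -/
noncomputable def stepProg {b : ℕ} (Y t : ℕ) : List (Round (St b) (Msg b)) :=
  localRound (fun _ => St.announce) :: (bcast t ++ (proposeRound t :: (ccast (t + 1) ++
    (localRound (fun _ => St.decide Y) :: (bcast (t + 1) ++ [localRound (St.conclude t)])))))

theorem stepProg_length {b : ℕ} (Y t : ℕ) : (stepProg (b := b) Y t).length = 3 * t + 6 := by
  simp [stepProg, bcast, ccast]
  ring

/-- Messages have O(b) bits; this makes the number of chunks constant when b and B are both of order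
log n. -/
theorem card_msg_le (b : ℕ) : Fintype.card (Msg b) ≤ 2 ^ (3 * b + 3) := by
  have h : 2 * b + 2 ≤ 2 ^ (b + 1) := by
    have := b.lt_two_pow_self
    rw [pow_succ]
    omega
  have h1 : Fintype.card (BitVec b) = 2 ^ b := by
    rw [Fintype.card_congr BitVec.equivFin.toEquiv, Fintype.card_fin]
  rw [Fintype.card_prod, Fintype.card_prod, Fintype.card_prod, Fintype.card_bool, Fintype.card_fin,
    ZMod.card, h1]
  calc 2 ^ b * ((2 * b + 2) * (2 * 2 ^ (b + 1)))
      ≤ 2 ^ b * (2 ^ (b + 1) * (2 * 2 ^ (b + 1))) := by gcongr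
    _ = 2 ^ (3 * b + 3) := by ring

section

variable {b d : ℕ} {r : Fin (2 * b + 2)} {m : Fin d → Msg b}

theorem bestPort_some {i : Fin d} (h : bestPort r m = some i) :
    (m i).2.2.1 = true ∧ (m i).2.1 < r ∧ ∀ j, (m j).2.2.1 = true → (m i).2.1 ≤ (m j).2.1 := by
  unfold bestPort at h
  split at h
  · rename_i hex
    cases h
    exact hex.choose_spec
  · cases h

theorem bestPort_none (h : bestPort r m = none) (j : Fin d) (hj : (m j).2.2.1 = true) :
    r ≤ (m j).2.1 := by
  unfold bestPort at h
  split at h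
  · cases h
  · rename_i hex
    by_contra hlt
    obtain ⟨i, hi, hmin⟩ := Set.exists_min_image {i | (m i).2.2.1 = true} (fun i => (m i).2.1)
      (Set.toFinite _) ⟨j, hj⟩
    exact hex ⟨i, hi, lt_of_le_of_lt (hmin j hj) (not_le.1 hlt), hmin⟩

end

/-! ### Edges seen from their two ends -/

namespace Network

variable {V : Type} {b : ℕ} (net : Network V b)

theorem nbr_backPort (v : V) (i : Fin (net.deg v)) :
    net.nbr (net.nbr v i) (net.backPort v i) = v := by
  change ((net.port (net.nbr v i)) ((net.port (net.nbr v i)).symm ⟨v, _⟩) : V) = v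
  rw [Equiv.apply_symm_apply]

theorem sigma_ext {x y : Σ v, Fin (net.deg v)} (h1 : x.1 = y.1)
    (h2 : net.nbr x.1 x.2 = net.nbr y.1 y.2) : x = y := by
  obtain ⟨v, i⟩ := x
  obtain ⟨w, j⟩ := y
  obtain rfl : v = w := h1
  have : i = j := (net.port v).injective (Subtype.ext h2)
  rw [this]

/-- The ports at the two ends of each edge. -/
def flip : (Σ v, Fin (net.deg v)) ≃ Σ v, Fin (net.deg v) where
  toFun x := ⟨net.nbr x.1 x.2, net.backPort x.1 x.2⟩
  invFun x := ⟨net.nbr x.1 x.2, net.backPort x.1 x.2⟩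
  left_inv _ := net.sigma_ext (net.nbr_backPort _ _) (net.nbr_backPort _ _)
  right_inv _ := net.sigma_ext (net.nbr_backPort _ _) (net.nbr_backPort _ _)

theorem flip_apply (v : V) (i : Fin (net.deg v)) :
    net.flip ⟨v, i⟩ = ⟨net.nbr v i, net.backPort v i⟩ := rfl

end Network

/-! ### Broadcast and summation along the histories -/

section Casts

variable {V : Type} {b : ℕ} {net : Network V b} {t : ℕ} {σ : V → St b}

/-- The consistency of the histories up to time `t`. -/
structure Hist (net : Network V b) (t : ℕ) (σ : V → St b) : Prop where
  id_eq : ∀ v, (σ v).id = net.ident v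
  zero : ∀ v, (σ v).cl 0 = net.ident v
  stay : ∀ v, ∀ τ < t, finPort (net.deg v) ((σ v).pt (τ + 1)) = none → (σ v).cl (τ + 1) = (σ v).cl τ
  move : ∀ v, ∀ τ < t, ∀ i, finPort (net.deg v) ((σ v).pt (τ + 1)) = some i →
    (σ (net.nbr v i)).cl τ = (σ v).cl (τ + 1)
  free : ∀ v, ∀ τ < t, ∀ i, finPort (net.deg v) ((σ v).pt (τ + 1)) = some i →
    (σ v).out = none ∧ (σ (net.nbr v i)).out = none

theorem Hist.mono (h : Hist net t σ) {s : ℕ} (hs : s ≤ t) : Hist net s σ :=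
  ⟨h.id_eq, h.zero, fun v τ hτ => h.stay v τ (hτ.trans_le hs),
    fun v τ hτ => h.move v τ (hτ.trans_le hs), fun v τ hτ => h.free v τ (hτ.trans_le hs)⟩

theorem Hist.exists_root (h : Hist net t σ) (v : V) {τ : ℕ} (hτ : τ ≤ t) :
    ∃ r, (σ v).cl τ = net.ident r := by
  induction τ generalizing v with
  | zero => exact ⟨v, h.zero v⟩
  | succ τ ih =>
    cases ho : finPort (net.deg v) ((σ v).pt (τ + 1)) with
    | none => rw [h.stay v τ hτ ho]; exact ih v (by omega)
    | some i => rw [← h.move v τ hτ i ho]; exact ih _ (by omega)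

/-- By induction on time, every vertex knows the correct data of all clusters it has visited so far.
A mover asks a neighbor that was in the same cluster one step earlier; a vertex that returns to a
cluster merely overwrites its entry by the same value. -/
theorem runAll_bcast (h : Hist net t σ) (D : BitVec b → Fin (2 * b + 2) × Bool)
    (hD : ∀ v, (σ v).know (net.ident v) = D (net.ident v)) :
    ∃ k : V → BitVec b → Fin (2 * b + 2) × Bool,
      runAll net (bcast t) σ = (fun v => { σ v with know := k v }) ∧
      ∀ v, ∀ τ ≤ t, k v ((σ v).cl τ) = D ((σ v).cl τ) := by
  induction t with
  | zero =>
    refine ⟨fun v => (σ v).know, rfl, fun v τ hτ => ?_⟩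
    obtain rfl : τ = 0 := by omega
    rw [h.zero]
    exact hD v
  | succ t ih =>
    obtain ⟨k, hk, hkD⟩ := ih (h.mono t.le_succ)
    rw [bcast, List.range_succ, List.map_append, runAll_append, ← bcast, hk]
    refine ⟨_, rfl, fun v τ hτ => ?_⟩
    dsimp only
    cases ho : finPort (net.deg v) ((σ v).pt (t + 1)) with
    | none =>
      dsimp only
      rcases hτ.eq_or_lt with rfl | hlt
      · rw [h.stay v t (by omega) ho]
        exact hkD v t le_rfl
      · exact hkD v τ (by omega)
    | some i =>
      dsimp only [bcastRound]
      by_cases e : (σ v).cl τ = (σ v).cl (t + 1)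
      · rw [e, Function.update_self, ← h.move v t (by omega) i ho]
        exact hkD _ t le_rfl
      · rw [Function.update_of_ne e]
        rcases hτ.eq_or_lt with rfl | hlt
        · exact absurd rfl e
        · exact hkD v τ (by omega)

/-- What a mover deletes is exactly what the neighbor it joined through adds: by `Hist.move` that
neighbor was in the same cluster at time t and so books the amount correctly. Reindexing by
`Network.flip` turns received messages into sent ones. -/
theorem sum_run_ccastRound [Fintype V] (h : Hist net (t + 1) σ) (C : BitVec b) :
    ∑ v, ((ccastRound t).run net σ v).acc C = ∑ v, (σ v).acc C := by
  have key := Equiv.sum_comp net.flip (fun x : Σ v, Fin (net.deg v) =>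
    if C = (σ (net.nbr x.1 x.2)).cl t then
      (if finPort (net.deg x.1) ((σ x.1).pt (t + 1)) = some x.2 then
        (σ x.1).acc ((σ x.1).cl (t + 1)) else 0) else 0)
  rw [Fintype.sum_sigma, Fintype.sum_sigma] at key
  simp only [net.flip_apply, net.nbr_backPort] at key
  simp only [Round.run, ccastRound, Finset.sum_add_distrib]
  have e1 : ∀ v, (if C = (σ v).cl t then ∑ i, (if finPort (net.deg (net.nbr v i))
      ((σ (net.nbr v i)).pt (t + 1)) = some (net.backPort v i) then
        (σ (net.nbr v i)).acc ((σ (net.nbr v i)).cl (t + 1)) else 0) else 0) =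
      ∑ i, if C = (σ v).cl t then (if finPort (net.deg (net.nbr v i))
      ((σ (net.nbr v i)).pt (t + 1)) = some (net.backPort v i) then
        (σ (net.nbr v i)).acc ((σ (net.nbr v i)).cl (t + 1)) else 0) else 0 := by
    intro v
    split <;> simp
  refine (congrArg₂ (· + ·) rfl ((Finset.sum_congr rfl fun v _ => e1 v).trans key)).trans ?_
  rw [← Finset.sum_add_distrib]
  refine Finset.sum_congr rfl fun v _ => ?_
  cases ho : finPort (net.deg v) ((σ v).pt (t + 1)) with
  | none => simp
  | some i =>
    have e2 : ∀ j, (if C = (σ (net.nbr v j)).cl t then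
        (if some i = some j then (σ v).acc ((σ v).cl (t + 1)) else 0) else 0) =
        if i = j then (if C = (σ v).cl (t + 1) then (σ v).acc ((σ v).cl (t + 1)) else 0) else 0 := by
      intro j
      by_cases hj : i = j
      · subst hj
        simp [h.move v t (by omega) i ho]
      · simp [hj]
    simp only [e2]
    rw [Finset.sum_ite_eq]
    by_cases hC : C = (σ v).cl (t + 1) <;> simp [hC]

/-- Each round preserves the total for a cluster and moves its support to vertices that were members
one step earlier. At time 0 the root is the only member, so it holds the whole sum. -/
theorem runAll_ccast [Fintype V] (h : Hist net t σ)
    (hs : ∀ v C, (σ v).acc C ≠ 0 → ∃ τ ≤ t, (σ v).cl τ = C) :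
    ∃ a : V → BitVec b → ZMod (2 ^ (b + 1)),
      runAll net (ccast t) σ = (fun v => { σ v with acc := a v }) ∧
      ∀ r, a r (net.ident r) = ∑ v, (σ v).acc (net.ident r) := by
  induction t generalizing σ with
  | zero =>
    refine ⟨fun v => (σ v).acc, rfl, fun r => ?_⟩
    rw [Finset.sum_eq_single r]
    · intro v _ hv
      by_contra hne
      obtain ⟨τ, hτ, e⟩ := hs v _ hne
      obtain rfl : τ = 0 := by omega
      rw [h.zero] at e
      exact hv (net.ident_injective e)
    · simp
  | succ t ih =>
    have hrun : ∃ a : V → BitVec b → ZMod (2 ^ (b + 1)),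
        (ccastRound t).run net σ = fun v => { σ v with acc := a v } := ⟨_, rfl⟩
    have hsum := sum_run_ccastRound h
    have hsupp : ∀ v C, ((ccastRound t).run net σ v).acc C ≠ 0 → ∃ τ ≤ t, (σ v).cl τ = C := by
      intro v C hne
      by_contra hno
      push Not at hno
      apply hne
      have h1 : C ≠ (σ v).cl t := fun e => hno t le_rfl e.symm
      simp only [Round.run, ccastRound, h1, if_false, add_zero]
      by_cases hmv : (finPort (net.deg v) ((σ v).pt (t + 1))).isSome = true ∧ C = (σ v).cl (t + 1)
      · simp [hmv]
      · rw [if_neg hmv]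
        by_contra hacc
        obtain ⟨τ, hτ, e⟩ := hs v C hacc
        rcases hτ.eq_or_lt with rfl | hlt
        · have : finPort (net.deg v) ((σ v).pt (t + 1)) = none := by
            rw [← Option.not_isSome_iff_eq_none]
            exact fun hsm => hmv ⟨hsm, e.symm⟩
          rw [h.stay v t (by omega) this] at e
          exact h1 e.symm
        · exact hno τ (by omega) e
    obtain ⟨a, ha⟩ := hrun
    rw [ha] at hsum hsupp
    have hh : Hist net t (fun v => { σ v with acc := a v }) :=
      let h' := h.mono t.le_succ
      ⟨h'.id_eq, h'.zero, h'.stay, h'.move, h'.free⟩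
    obtain ⟨a', h1, h2⟩ := ih hh hsupp
    refine ⟨a', ?_, fun r => (h2 r).trans (hsum _)⟩
    rw [ccast, List.range_succ, List.map_append, List.reverse_append, runAll_append, ← ccast]
    simp only [List.map_cons, List.map_nil, List.reverse_cons, List.reverse_nil, List.nil_append,
      runAll_cons, runAll_nil]
    rw [ha, h1]

end Casts

/-! ### The program performs a step of the process -/

section Step

variable {V : Type} {b : ℕ} {net : Network V b} {t : ℕ} {σ : V → St b} {ρ : BitVec b → V}

/-- The configuration at time `t` that is described by the local states `σ`, where `ρ` assigns to
each identifier the vertex that carries it. -/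
def toCfg (net : Network V b) (ρ : BitVec b → V) (t : ℕ) (σ : V → St b) : Cfg V where
  alive v := (σ v).alive
  cl v := ρ ((σ v).cl t)
  lev v := (σ v).lev
  tok v := (σ v).tok
  stl v := (σ v).stl
  mov v := ((Finset.range t).filter fun τ =>
    (finPort (net.deg v) ((σ v).pt (τ + 1))).isSome = true).card

/-- The states after the proposals `o` have been recorded as tentative moves. -/
def tentative (net : Network V b) (t : ℕ) (σ : V → St b) (o : ∀ v, Option (Fin (net.deg v)))
    (k : V → BitVec b → Fin (2 * b + 2) × Bool) : V → St b := fun v =>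
  { σ v with
    cl := Function.update (σ v).cl (t + 1)
      (((o v).map fun i => (σ (net.nbr v i)).cl t).getD ((σ v).cl t))
    pt := Function.update (σ v).pt (t + 1) ((o v).map Fin.val)
    know := k v
    acc := fun C => if (o v).map (fun i => (σ (net.nbr v i)).cl t) = some C then 1 else 0 }

theorem Hist.ident_root (h : Hist net t σ) (hρ : ∀ v, ρ (net.ident v) = v) (v : V) {τ : ℕ}
    (hτ : τ ≤ t) : net.ident (ρ ((σ v).cl τ)) = (σ v).cl τ := by
  obtain ⟨r, hr⟩ := h.exists_root v hτ
  rw [hr, hρ]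

theorem exists_proposal (hρ : ∀ v, ρ (net.ident v) = v) (h : Hist net t σ)
    (hlev : ∀ v, (σ v).lev ≤ b) :
    ∃ (o : ∀ v, Option (Fin (net.deg v))) (k : V → BitVec b → Fin (2 * b + 2) × Bool),
      runAll net (localRound (fun _ => St.announce) :: (bcast t ++ [proposeRound t])) σ =
        tentative net t σ o k ∧
      (toCfg net ρ t σ).IsProposal net.graph net.ident (fun v => (o v).map (net.nbr v)) := by
  let σ' : V → St b := fun v => (σ v).announce
  have h' : Hist net t σ' := ⟨h.id_eq, h.zero, h.stay, h.move, h.free⟩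
  obtain ⟨k, hk, hkD⟩ := runAll_bcast h'
    (fun C => (Fin.ofNat (2 * b + 2) (rankOf C (σ (ρ C)).lev), (σ (ρ C)).stl)) (by
      intro v
      simp only [σ', St.announce, h.id_eq, Function.update_self, hρ])
  have hk1 : ∀ v, ((k v ((σ v).cl t)).1 : ℕ) = (toCfg net ρ t σ).rank net.ident (ρ ((σ v).cl t)) := by
    intro v
    rw [show k v ((σ v).cl t) = _ from hkD v t le_rfl]
    simp only [Fin.val_ofNat, Cfg.rank, toCfg]
    rw [h.ident_root hρ v le_rfl]
    exact Nat.mod_eq_of_lt (rankOf_lt _ (hlev _))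
  have hk2 : ∀ v, (k v ((σ v).cl t)).2 = (σ (ρ ((σ v).cl t))).stl := by
    intro v
    exact congrArg Prod.snd (hkD v t le_rfl)
  let m : ∀ v, Fin (net.deg v) → Msg b := fun v i =>
    ((σ (net.nbr v i)).cl t, (k (net.nbr v i) ((σ (net.nbr v i)).cl t)).1,
      (σ (net.nbr v i)).alive && !(k (net.nbr v i) ((σ (net.nbr v i)).cl t)).2, 0)
  let o : ∀ v, Option (Fin (net.deg v)) := fun v =>
    if (σ v).alive then bestPort (k v ((σ v).cl t)).1 (m v) else none
  have key : ∀ v u, (o v).map (net.nbr v) = some u → ∃ i, net.nbr v i = u ∧ (σ v).alive = true ∧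
      bestPort (k v ((σ v).cl t)).1 (m v) = some i := by
    intro v u hu
    rw [Option.map_eq_some_iff] at hu
    obtain ⟨i, hi, rfl⟩ := hu
    by_cases ha : (σ v).alive = true
    · exact ⟨i, rfl, ha, by simpa [o, ha] using hi⟩
    · simp [o, ha] at hi
  have avail : ∀ v w, net.graph.Adj v w → (σ w).alive = true → (σ (ρ ((σ w).cl t))).stl = false →
      ∃ j, net.nbr v j = w ∧ (m v j).2.2.1 = true := by
    intro v w hvw hw hs
    have e : net.nbr v ((net.port v).symm ⟨w, hvw⟩) = w := by
      change ((net.port v) ((net.port v).symm ⟨w, hvw⟩) : V) = w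
      rw [Equiv.apply_symm_apply]
    refine ⟨(net.port v).symm ⟨w, hvw⟩, e, ?_⟩
    simp [m, e, hw, hk2, hs]
  refine ⟨o, k, ?_, ?_, ?_, ?_, ?_, ?_, ?_, ?_⟩
  · rw [runAll_cons, runAll_append, show (localRound (fun _ => St.announce)).run net σ = σ' from rfl,
      hk]
    rfl
  · intro v u hu
    obtain ⟨i, -, ha, -⟩ := key v u hu
    exact ha
  · intro v u hu
    obtain ⟨i, rfl, -, hi⟩ := key v u hu
    have := (bestPort_some hi).1
    simp only [m, Bool.and_eq_true] at this
    exact this.1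
  · intro v u hu
    obtain ⟨i, rfl, -, -⟩ := key v u hu
    exact net.adj_nbr v i
  · intro v u hu
    obtain ⟨i, rfl, -, hi⟩ := key v u hu
    have := (bestPort_some hi).1
    simp only [m, Bool.and_eq_true, hk2, Bool.not_eq_true'] at this
    exact this.2
  · intro v u hu
    obtain ⟨i, rfl, -, hi⟩ := key v u hu
    have := (bestPort_some hi).2.1
    rw [Fin.lt_def, hk1, hk1] at this
    exact this
  · intro v u hu w hvw hw hs
    obtain ⟨i, rfl, -, hi⟩ := key v u hu
    obtain ⟨j, rfl, hj⟩ := avail v w hvw hw hs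
    have := (bestPort_some hi).2.2 j hj
    rw [Fin.le_def] at this
    simp only [m, hk1] at this
    exact this
  · intro v hv ha w hvw hw hs
    obtain ⟨j, rfl, hj⟩ := avail v w hvw hw hs
    change (σ v).alive = true at ha
    have hn : bestPort (k v ((σ v).cl t)).1 (m v) = none := by
      simpa [o, ha] using hv
    have := bestPort_none hn j hj
    rw [Fin.le_def, hk1] at this
    simp only [m, hk1] at this
    exact this

/-- Recording the proposals as moves before they are accepted gives a valid history up to t + 1.
Along it the proposals are counted and the verdicts returned by the same two casts. -/
theorem Hist.tentative (h : Hist net t σ) {o : ∀ v, Option (Fin (net.deg v))}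
    {k : V → BitVec b → Fin (2 * b + 2) × Bool}
    (hfree : ∀ v i, o v = some i → (σ v).out = none ∧ (σ (net.nbr v i)).out = none) :
    Hist net (t + 1) (tentative net t σ o k) where
  id_eq := h.id_eq
  zero v := by simpa [Congest.tentative] using h.zero v
  stay v τ hτ hn := by
    rcases (Nat.lt_succ_iff.1 hτ).eq_or_lt with rfl | hlt
    · simp_all [Congest.tentative]
    · have := h.stay v τ hlt
      simp_all [Congest.tentative, Function.update, hlt.ne, (hlt.trans (Nat.lt_succ_self t)).ne]
  move v τ hτ i hi := by
    rcases (Nat.lt_succ_iff.1 hτ).eq_or_lt with rfl | hlt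
    · simp_all [Congest.tentative]
    · have := h.move v τ hlt i
      simp_all [Congest.tentative, Function.update, hlt.ne, (hlt.trans (Nat.lt_succ_self t)).ne]
  free v τ hτ i hi := by
    rcases (Nat.lt_succ_iff.1 hτ).eq_or_lt with rfl | hlt
    · exact hfree v i (by simpa [Congest.tentative] using hi)
    · refine h.free v τ hlt i ?_
      simpa [Congest.tentative, Function.update, hlt.ne] using hi

theorem card_filter_update_pt (d t : ℕ) (f : ℕ → Option ℕ) (o : Option (Fin d)) :
    ((Finset.range (t + 1)).filter fun τ =>
      (finPort d (Function.update f (t + 1) (o.map Fin.val) (τ + 1))).isSome = true).card =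
    ((Finset.range t).filter fun τ => (finPort d (f (τ + 1))).isSome = true).card +
      if o.isSome then 1 else 0 := by
  rw [Finset.card_filter, Finset.sum_range_succ, Finset.card_filter]
  congr 1
  · refine Finset.sum_congr rfl fun τ hτ => ?_
    rw [Function.update_of_ne]
    have := Finset.mem_range.1 hτ
    omega
  · simp

variable [Fintype V] [DecidableEq V]

/-- Roots announce ranks, vertices propose, roots count the proposals and announce the verdict, and
rejected vertices undo their tentative move. Which neighbor of least rank is chosen is irrelevant;
the process only asks for some valid proposal function. -/
theorem runAll_stepProg (hρ : ∀ v, ρ (net.ident v) = v) (hcard : Fintype.card V ≤ 2 ^ b)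
    (h : Hist net t σ) (hlev : ∀ v, (σ v).lev ≤ b)
    (hfree : ∀ v, (σ v).alive = true → (σ v).out = none) (Y : ℕ) :
    ∃ tgt, (toCfg net ρ t σ).IsProposal net.graph net.ident tgt ∧
      toCfg net ρ (t + 1) (runAll net (stepProg Y t) σ) = (toCfg net ρ t σ).step Y tgt ∧
      Hist net (t + 1) (runAll net (stepProg Y t) σ) ∧
      ∀ v, (runAll net (stepProg Y t) σ v).out = (σ v).out ∧
        (runAll net (stepProg Y t) σ v).tr = (σ v).tr := by
  obtain ⟨o, k, hrun, hprop⟩ := exists_proposal hρ h hlev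
  set tgt : V → Option V := fun v => (o v).map (net.nbr v) with htgt
  set c := toCfg net ρ t σ with hc
  have hT : Hist net (t + 1) (tentative net t σ o k) := h.tentative fun v i hi =>
    ⟨hfree v (hprop.alive_left v (net.nbr v i) (by simp [htgt, hi])),
      hfree _ (hprop.alive_right v (net.nbr v i) (by simp [htgt, hi]))⟩
  obtain ⟨a, ha, hsum⟩ := runAll_ccast hT (by
    intro v C hC
    refine ⟨t + 1, le_rfl, ?_⟩
    simp only [tentative] at hC ⊢
    have : (o v).map (fun i => (σ (net.nbr v i)).cl t) = some C := by
      by_contra hne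
      exact hC (if_neg hne)
    simp [this])
  have hmem : ∀ v r, (o v).map (fun i => (σ (net.nbr v i)).cl t) = some (net.ident r) ↔
      (tgt v).map c.cl = some r := by
    intro v r
    cases ho : o v with
    | none => simp [htgt, ho]
    | some i =>
      simp only [htgt, ho, Option.map_some, Option.some.injEq, hc, toCfg]
      constructor
      · intro e; rw [e, hρ]
      · intro e; rw [← e, h.ident_root hρ _ le_rfl]
  have hval : ∀ r, (a r (net.ident r)).val = (c.proposers tgt r).card := by
    intro r
    rw [hsum]
    simp only [tentative, hmem]
    rw [Finset.sum_boole]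
    -- There is no overflow: at most 2^b vertices propose and the counter is taken modulo 2^(b+1).
    refine ZMod.val_natCast_of_lt ?_
    refine lt_of_le_of_lt (Finset.card_le_univ _) (lt_of_le_of_lt hcard ?_)
    exact Nat.pow_lt_pow_right (by norm_num) (by omega)
  have hdec : ∀ r, decide ((σ r).tok ≤ 2 * Y * (a r (net.ident r)).val) = c.accepts Y tgt r := by
    intro r
    rw [hval]
    rfl
  let σ5 : V → St b := fun v => St.decide Y { tentative net t σ o k v with acc := a v }
  have hH5 : Hist net (t + 1) σ5 := ⟨hT.id_eq, hT.zero, hT.stay, hT.move, hT.free⟩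
  obtain ⟨k', hk', hkD⟩ := runAll_bcast hH5 (fun C => (0, c.accepts Y tgt (ρ C))) (by
    intro v
    simp only [σ5, St.decide, tentative, h.id_eq, Function.update_self, hρ, hdec])
  have hfin : runAll net (stepProg Y t) σ =
      fun v => St.conclude t (net.deg v) { σ5 v with know := k' v } := by
    have e : (stepProg Y t : List (Round (St b) (Msg b))) =
        (localRound (fun _ => St.announce) :: (bcast t ++ [proposeRound t])) ++ (ccast (t + 1) ++
        (localRound (fun _ => St.decide Y) :: (bcast (t + 1) ++ [localRound (St.conclude t)]))) := by
      simp [stepProg]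
    rw [e, runAll_append, hrun, runAll_append, ha, runAll_cons, runAll_append,
      show (localRound (fun _ => St.decide Y)).run net
        (fun v => { tentative net t σ o k v with acc := a v }) = σ5 from rfl, hk']
    rfl
  have hnone : ∀ v, o v = none → runAll net (stepProg Y t) σ v = { σ5 v with know := k' v } := by
    intro v hv
    rw [hfin]
    simp [St.conclude, σ5, St.decide, tentative, hv]
  have hacc : ∀ v i, o v = some i → c.accepts Y tgt (c.cl (net.nbr v i)) = true →
      runAll net (stepProg Y t) σ v = { σ5 v with know := k' v } := by
    intro v i hv hai
    have := hkD v (t + 1) le_rfl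
    rw [hfin]
    simp only [σ5, St.decide, tentative, Function.update_self, hv, Option.map_some,
      Option.getD_some] at this
    rw [show ρ ((σ (net.nbr v i)).cl t) = c.cl (net.nbr v i) from rfl, hai] at this
    simp [St.conclude, σ5, St.decide, tentative, hv, this]
  have hrej : ∀ v i, o v = some i → c.accepts Y tgt (c.cl (net.nbr v i)) = false →
      runAll net (stepProg Y t) σ v = { σ5 v with
        know := k' v
        alive := false
        cl := Function.update (σ v).cl (t + 1) ((σ v).cl t)
        pt := Function.update (σ v).pt (t + 1) none } := by
    intro v i hv hai
    have := hkD v (t + 1) le_rfl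
    rw [hfin]
    simp only [σ5, St.decide, tentative, Function.update_self, hv, Option.map_some,
      Option.getD_some] at this
    rw [show ρ ((σ (net.nbr v i)).cl t) = c.cl (net.nbr v i) from rfl, hai] at this
    simp [St.conclude, σ5, St.decide, tentative, hv, this]
  -- In the history a rejected vertex looks like one that never proposed; only accepted proposals
  -- remain as moves.
  have hcases : ∀ v,
      ((runAll net (stepProg Y t) σ v).pt = Function.update (σ v).pt (t + 1) none ∧
        (runAll net (stepProg Y t) σ v).cl = Function.update (σ v).cl (t + 1) ((σ v).cl t)) ∨
      ∃ i, o v = some i ∧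
        (runAll net (stepProg Y t) σ v).pt = Function.update (σ v).pt (t + 1) (some i) ∧
        (runAll net (stepProg Y t) σ v).cl =
          Function.update (σ v).cl (t + 1) ((σ (net.nbr v i)).cl t) := by
    intro v
    cases ho : o v with
    | none => exact Or.inl (by simp [hnone v ho, σ5, St.decide, tentative, ho])
    | some i =>
      cases hi : c.accepts Y tgt (c.cl (net.nbr v i)) with
      | false => exact Or.inl (by simp [hrej v i ho hi])
      | true => exact Or.inr ⟨i, rfl, by simp [hacc v i ho hi, σ5, St.decide, tentative, ho]⟩
  have hsame : ∀ v, (runAll net (stepProg Y t) σ v).id = (σ v).id ∧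
      (runAll net (stepProg Y t) σ v).lev = (σ v).lev ∧
      (runAll net (stepProg Y t) σ v).tok = (c.step Y tgt).tok v ∧
      (runAll net (stepProg Y t) σ v).stl = (c.step Y tgt).stl v ∧
      (runAll net (stepProg Y t) σ v).out = (σ v).out ∧
      (runAll net (stepProg Y t) σ v).tr = (σ v).tr := by
    intro v
    have e : (σ5 v).id = (σ v).id ∧ (σ5 v).lev = (σ v).lev ∧
        (σ5 v).tok = (c.step Y tgt).tok v ∧ (σ5 v).stl = (c.step Y tgt).stl v ∧
        (σ5 v).out = (σ v).out ∧ (σ5 v).tr = (σ v).tr := by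
      refine ⟨rfl, rfl, ?_, ?_, rfl, rfl⟩
      · simp only [σ5, St.decide, tentative, h.id_eq, hval, Cfg.step]
        rfl
      · simp only [σ5, St.decide, tentative, h.id_eq, hdec, Cfg.step]
        rfl
    cases ho : o v with
    | none => rw [hnone v ho]; exact e
    | some i =>
      cases hi : c.accepts Y tgt (c.cl (net.nbr v i)) with
      | false => rw [hrej v i ho hi]; exact e
      | true => rw [hacc v i ho hi]; exact e
  have hcl : ∀ v, ∀ τ ≤ t, (runAll net (stepProg Y t) σ v).cl τ = (σ v).cl τ := by
    intro v τ hτ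
    rcases hcases v with ⟨-, e⟩ | ⟨i, -, -, e⟩ <;>
      rw [e, Function.update_of_ne (by omega)]
  have hpt : ∀ v, ∀ τ < t, (runAll net (stepProg Y t) σ v).pt (τ + 1) = (σ v).pt (τ + 1) := by
    intro v τ hτ
    rcases hcases v with ⟨e, -⟩ | ⟨i, -, e, -⟩ <;>
      rw [e, Function.update_of_ne (by omega)]
  refine ⟨tgt, hprop, ?_, ⟨?_, ?_, ?_, ?_, ?_⟩, fun v => (hsame v).2.2.2.2⟩
  · ext v
    · cases ho : o v with
      | none => simp [toCfg, Cfg.step, htgt, ho, hnone v ho, σ5, St.decide, tentative, hc]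
      | some i =>
        cases hi : c.accepts Y tgt (c.cl (net.nbr v i)) with
        | false =>
          rw [show (toCfg net ρ (t + 1) (runAll net (stepProg Y t) σ)).alive v = false by
            simp [toCfg, hrej v i ho hi]]
          simp [Cfg.step, show tgt v = some (net.nbr v i) by simp [htgt, ho], hi]
        | true =>
          rw [show (toCfg net ρ (t + 1) (runAll net (stepProg Y t) σ)).alive v = c.alive v by
            simp [toCfg, hacc v i ho hi, σ5, St.decide, tentative, hc]]
          simp [Cfg.step, show tgt v = some (net.nbr v i) by simp [htgt, ho], hi]
    · cases ho : o v with
      | none => simp [toCfg, Cfg.step, htgt, ho, hnone v ho, σ5, St.decide, tentative, hc]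
      | some i =>
        cases hi : c.accepts Y tgt (c.cl (net.nbr v i)) with
        | false =>
          rw [show (toCfg net ρ (t + 1) (runAll net (stepProg Y t) σ)).cl v = c.cl v by
            simp [toCfg, hrej v i ho hi, hc]]
          simp [Cfg.step, show tgt v = some (net.nbr v i) by simp [htgt, ho], hi]
        | true =>
          rw [show (toCfg net ρ (t + 1) (runAll net (stepProg Y t) σ)).cl v = c.cl (net.nbr v i) by
            simp [toCfg, hacc v i ho hi, σ5, St.decide, tentative, hc, ho]]
          simp [Cfg.step, show tgt v = some (net.nbr v i) by simp [htgt, ho], hi]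
    · exact (hsame v).2.1
    · exact (hsame v).2.2.1
    · exact (hsame v).2.2.2.1
    · change ((Finset.range (t + 1)).filter fun τ => (finPort (net.deg v)
        ((runAll net (stepProg Y t) σ v).pt (τ + 1))).isSome = true).card = _
      cases ho : o v with
      | none =>
        have := card_filter_update_pt (net.deg v) t (σ v).pt none
        simp only [hnone v ho, σ5, St.decide, tentative, ho]
        rw [this]
        simp [Cfg.step, show tgt v = none by simp [htgt, ho], hc, toCfg]
      | some i =>
        cases hi : c.accepts Y tgt (c.cl (net.nbr v i)) with
        | false =>
          have := card_filter_update_pt (net.deg v) t (σ v).pt none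
          simp only [hrej v i ho hi]
          rw [Option.map_none] at this
          rw [this]
          simp only [Cfg.step, show tgt v = some (net.nbr v i) by simp [htgt, ho], hi]
          simp [hc, toCfg]
        | true =>
          have := card_filter_update_pt (net.deg v) t (σ v).pt (some i)
          simp only [hacc v i ho hi, σ5, St.decide, tentative, ho]
          rw [this]
          simp only [Cfg.step, show tgt v = some (net.nbr v i) by simp [htgt, ho], hi]
          simp [hc, toCfg]
  · intro v
    rw [(hsame v).1, h.id_eq]
  · intro v
    rw [hcl v 0 (Nat.zero_le _), h.zero]
  · intro v τ hτ hn
    rcases (Nat.lt_succ_iff.1 hτ).eq_or_lt with rfl | hlt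
    · rcases hcases v with ⟨e1, e2⟩ | ⟨i, -, e1, e2⟩
      · rw [hcl v τ le_rfl, e2, Function.update_self]
      · simp [e1] at hn
    · rw [hpt v τ hlt] at hn
      rw [hcl v _ hlt, hcl v τ hlt.le, h.stay v τ hlt hn]
  · intro v τ hτ i hi
    rcases (Nat.lt_succ_iff.1 hτ).eq_or_lt with rfl | hlt
    · rcases hcases v with ⟨e1, e2⟩ | ⟨j, -, e1, e2⟩
      · simp [e1] at hi
      · obtain rfl : j = i := by simpa [e1] using hi
        rw [hcl _ τ le_rfl, e2, Function.update_self]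
    · rw [hpt v τ hlt] at hi
      rw [hcl v _ hlt, hcl _ τ hlt.le, h.move v τ hlt i hi]
  · intro v τ hτ i hi
    rw [(hsame v).2.2.2.2.1, (hsame _).2.2.2.2.1]
    rcases (Nat.lt_succ_iff.1 hτ).eq_or_lt with rfl | hlt
    · rcases hcases v with ⟨e1, e2⟩ | ⟨j, ho, e1, e2⟩
      · simp [e1] at hi
      · obtain rfl : j = i := by simpa [e1] using hi
        exact ⟨hfree v (hprop.alive_left v (net.nbr v j) (by simp [htgt, ho])),
          hfree _ (hprop.alive_right v (net.nbr v j) (by simp [htgt, ho]))⟩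
    · rw [hpt v τ hlt] at hi
      exact h.free v τ hlt i hi

end Step

/-! ### Steiner trees -/

/-- A graph given by a parent function that decreases `f` is a tree whose depth is bounded
by `f`. -/
theorem isTree_of_parent {W : Type} [Finite W] (H : SimpleGraph W) (r : W) (p : W → W) (f : W → ℕ)
    (hp : ∀ v, v ≠ r → H.Adj v (p v) ∧ f (p v) < f v)
    (hadj : ∀ u v, H.Adj u v → (u ≠ r ∧ p u = v) ∨ (v ≠ r ∧ p v = u)) :
    H.IsTree ∧ ∀ v, H.edist r v ≤ f v := by
  have hw : ∀ n v, f v = n → ∃ w : H.Walk r v, w.length ≤ f v := by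
    intro n
    induction n using Nat.strong_induction_on with
    | _ n ih =>
      intro v hv
      by_cases e : v = r
      · subst e
        exact ⟨SimpleGraph.Walk.nil, Nat.zero_le _⟩
      · obtain ⟨h1, h2⟩ := hp v e
        obtain ⟨w, hw⟩ := ih _ (hv ▸ h2) (p v) rfl
        refine ⟨w.concat h1.symm, ?_⟩
        rw [SimpleGraph.Walk.length_concat]
        omega
  have hconn : H.Connected := by
    rw [SimpleGraph.connected_iff_exists_forall_reachable]
    exact ⟨r, fun v => (hw _ v rfl).elim fun w _ => w.reachable⟩
  refine ⟨?_, fun v => ?_⟩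
  · rw [SimpleGraph.isTree_iff_connected_and_card]
    refine ⟨hconn, le_antisymm ?_ hconn.card_vert_le_card_edgeSet_add_one⟩
    -- Every edge is the parent edge of a vertex other than the root, so there are fewer edges than
    -- vertices; a connected graph with this property is a tree.
    have hsub : H.edgeSet ⊆ (fun v => s(v, p v)) '' ({r}ᶜ : Set W) := by
      intro e
      induction e with
      | _ u v =>
        intro huv
        rcases hadj u v huv with ⟨h1, h2⟩ | ⟨h1, h2⟩
        · exact ⟨u, h1, by simp [h2]⟩
        · exact ⟨v, h1, by simp [h2, Sym2.eq_swap]⟩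
    have h1 : Nat.card H.edgeSet ≤ ({r}ᶜ : Set W).ncard := by
      rw [Nat.card_coe_set_eq]
      exact (Set.ncard_le_ncard hsub (Set.toFinite _)).trans (Set.ncard_image_le (Set.toFinite _))
    have h2 := Set.ncard_add_ncard_compl ({r} : Set W)
    rw [Set.ncard_singleton] at h2
    omega
  · obtain ⟨w, hw⟩ := hw _ v rfl
    exact (SimpleGraph.edist_le w).trans (by exact_mod_cast hw)

/-- The vertex joins a cluster for the first time at time `τ + 1`, through port `i`. -/
def St.Joins {b : ℕ} (s : St b) (d τ : ℕ) (i : Fin d) : Prop :=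
  finPort d (s.pt (τ + 1)) = some i ∧ ∀ τ' ≤ τ, s.cl τ' ≠ s.cl (τ + 1)

/-- The edge at port `i` leads to the parent in the Steiner tree of the cluster `C`. -/
def St.IsParentPort {b : ℕ} (T : ℕ) (s : St b) (d : ℕ) (C : BitVec b) (i : Fin d) : Prop :=
  ∃ τ < T, s.Joins d τ i ∧ s.cl (τ + 1) = C

open Classical in
/-- Initializes the Steiner trees of color `j` with the edges to the parents. -/
noncomputable def St.initTrees {b : ℕ} (j T d : ℕ) (s : St b) : St b :=
  { s with
    tr := Function.update s.tr j fun C =>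
      if s.out = none ∧ ∃ τ ≤ T, s.cl τ = C then
        some ((Finset.univ.filter fun i : Fin d => s.IsParentPort T d C i).image Fin.val)
      else none }

open Classical in
/-- The vertices that joined a cluster at time `τ + 1` inform their parents. -/
noncomputable def treeRound {b : ℕ} (j τ : ℕ) : Round (St b) (Msg b) where
  send d s i := (0, 0, decide (s.Joins d τ i), 0)
  step d s m :=
    { s with
      tr := Function.update s.tr j fun C =>
        if s.cl τ = C then (s.tr j C).map fun S =>
          S ∪ (Finset.univ.filter fun i : Fin d => (m i).2.2.1 = true).image Fin.val
        else s.tr j C }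

/-- A vertex knows its own parent edges. To learn the edges to its children one flag per round
suffices, since a message in round τ can only concern the receiver's cluster at time τ. -/
noncomputable def treeProg {b : ℕ} (j T : ℕ) : List (Round (St b) (Msg b)) :=
  localRound (St.initTrees j T) :: (List.range T).map (treeRound j)

theorem treeProg_length {b : ℕ} (j T : ℕ) : (treeProg (b := b) j T).length = T + 1 := by
  simp [treeProg]

section

variable {V : Type} {b : ℕ} {net : Network V b} {T : ℕ} {σ : V → St b}

/-- `Hist.move` identifies the cluster that a child's flag refers to, and `Hist.free` ensures that
the parent is itself in the tree, so that there is a port set to be extended. -/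
theorem runAll_treeRound (h : Hist net T σ) (j s : ℕ) (hs : s ≤ T) :
    ∃ g : V → BitVec b → Option (Finset ℕ),
      runAll net (localRound (St.initTrees j T) :: (List.range s).map (treeRound j)) σ =
        (fun v => { σ v with tr := Function.update (σ v).tr j (g v) }) ∧
      (∀ v C, (g v C).isSome ↔ (σ v).out = none ∧ ∃ τ ≤ T, (σ v).cl τ = C) ∧
      ∀ v C (i : Fin (net.deg v)), (∃ S, g v C = some S ∧ (i : ℕ) ∈ S) ↔
        (σ v).IsParentPort T (net.deg v) C i ∨
        ∃ τ < s, (σ (net.nbr v i)).Joins (net.deg (net.nbr v i)) τ (net.backPort v i) ∧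
          (σ (net.nbr v i)).cl (τ + 1) = C := by
  classical
  induction s with
  | zero =>
    refine ⟨fun v C => if (σ v).out = none ∧ ∃ τ ≤ T, (σ v).cl τ = C then
        some ((Finset.univ.filter fun i : Fin (net.deg v) =>
          (σ v).IsParentPort T (net.deg v) C i).image Fin.val) else none,
      rfl, fun v C => ?_, fun v C i => ?_⟩
    · dsimp only
      split <;> simp_all
    · dsimp only
      have hpar : (σ v).IsParentPort T (net.deg v) C i →
          (σ v).out = none ∧ ∃ τ ≤ T, (σ v).cl τ = C := by
        rintro ⟨τ, hτ, ⟨hp, -⟩, rfl⟩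
        exact ⟨(h.free v τ hτ i hp).1, τ + 1, hτ, rfl⟩
      by_cases hc : (σ v).out = none ∧ ∃ τ ≤ T, (σ v).cl τ = C
      · rw [if_pos hc]
        simp [Fin.val_inj]
      · rw [if_neg hc]
        simp only [reduceCtorEq, false_and, exists_false, Nat.not_lt_zero, or_false, false_iff]
        exact fun h => hc (hpar h)
  | succ s ih =>
    obtain ⟨g, hg, hg1, hg2⟩ := ih (by omega)
    rw [List.range_succ, List.map_append, ← List.cons_append, runAll_append, hg]
    refine ⟨fun v C => if (σ v).cl s = C then (g v C).map fun S =>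
          S ∪ (Finset.univ.filter fun i : Fin (net.deg v) =>
            decide ((σ (net.nbr v i)).Joins (net.deg (net.nbr v i)) s (net.backPort v i)) =
              true).image Fin.val
        else g v C, ?_, fun v C => ?_, fun v C i => ?_⟩
    · funext v
      simp only [runAll_cons, runAll_nil, List.map_cons, List.map_nil, Round.run, treeRound,
        Function.update_self, Function.update_idem]
      rfl
    · dsimp only
      rw [← hg1]
      split <;> simp
    · dsimp only
      have hmv : (σ (net.nbr v i)).Joins (net.deg (net.nbr v i)) s (net.backPort v i) →
          (σ v).cl s = (σ (net.nbr v i)).cl (s + 1) ∧ (σ v).out = none := by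
        rintro ⟨hp, -⟩
        have h1 := h.move _ s (by omega) _ hp
        have h2 := h.free _ s (by omega) _ hp
        rw [net.nbr_backPort] at h1 h2
        exact ⟨h1, h2.2⟩
      have hlt : (∃ τ < s + 1, (σ (net.nbr v i)).Joins (net.deg (net.nbr v i)) τ
          (net.backPort v i) ∧ (σ (net.nbr v i)).cl (τ + 1) = C) ↔
          (∃ τ < s, (σ (net.nbr v i)).Joins (net.deg (net.nbr v i)) τ
          (net.backPort v i) ∧ (σ (net.nbr v i)).cl (τ + 1) = C) ∨
          ((σ (net.nbr v i)).Joins (net.deg (net.nbr v i)) s (net.backPort v i) ∧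
            (σ (net.nbr v i)).cl (s + 1) = C) := by
        constructor
        · rintro ⟨τ, hτ, h1⟩
          rcases (Nat.lt_succ_iff.1 hτ).eq_or_lt with rfl | hlt
          · exact Or.inr h1
          · exact Or.inl ⟨τ, hlt, h1⟩
        · rintro (⟨τ, hτ, h1⟩ | h1)
          · exact ⟨τ, by omega, h1⟩
          · exact ⟨s, by omega, h1⟩
      rw [hlt, ← or_assoc, ← hg2 v C i]
      by_cases hC : (σ v).cl s = C
      · rw [if_pos hC]
        constructor
        · rintro ⟨S, hS, hi⟩
          rw [Option.map_eq_some_iff] at hS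
          obtain ⟨S', hS', rfl⟩ := hS
          rw [Finset.mem_union] at hi
          rcases hi with hi | hi
          · exact Or.inl ⟨S', hS', hi⟩
          · right
            simp only [decide_eq_true_eq, Finset.mem_image, Finset.mem_filter, Finset.mem_univ, true_and, Fin.val_inj,
              exists_eq_right] at hi
            exact ⟨hi, (hmv hi).1.symm.trans hC⟩
        · rintro (⟨S, hS, hi⟩ | ⟨hi, -⟩)
          · exact ⟨_, by rw [hS, Option.map_some], Finset.mem_union_left _ hi⟩
          · have := (hg1 v C).2 ⟨(hmv hi).2, s, by omega, hC⟩
            obtain ⟨S, hS⟩ := Option.isSome_iff_exists.1 this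
            refine ⟨_, by rw [hS, Option.map_some], Finset.mem_union_right _ ?_⟩
            simpa [Fin.val_inj] using hi
      · rw [if_neg hC]
        refine ⟨Or.inl, ?_⟩
        rintro (hl | ⟨hi, e⟩)
        · exact hl
        · exact absurd ((hmv hi).1.trans e) hC

/-- The program `treeProg` records a Steiner tree of every cluster. -/
theorem runAll_treeProg [Finite V] (h : Hist net T σ) (j : ℕ) :
    ∃ g : V → BitVec b → Option (Finset ℕ),
      runAll net (treeProg j T) σ =
        (fun v => { σ v with tr := Function.update (σ v).tr j (g v) }) ∧
      (∀ v C, (g v C).isSome ↔ (σ v).out = none ∧ ∃ τ ≤ T, (σ v).cl τ = C) ∧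
      ∀ C, (∃ v, (g v C).isSome) → ∃ (S : net.graph.Subgraph) (r : S.verts),
        (∀ v, v ∈ S.verts ↔ (g v C).isSome) ∧
        (∀ v i, S.Adj v (net.nbr v i) ↔ ∃ s, g v C = some s ∧ (i : ℕ) ∈ s) ∧
        S.coe.IsTree ∧ ∀ v, S.coe.edist r v ≤ T := by
  classical
  obtain ⟨g, hg, hg1, hg2⟩ := runAll_treeRound h j T le_rfl
  refine ⟨g, hg, hg1, fun C hne => ?_⟩
  let M : V → Prop := fun v => (σ v).out = none ∧ ∃ τ ≤ T, (σ v).cl τ = C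
  -- The time of first membership decreases towards the parent, which belonged to the cluster
  -- earlier. It serves as the depth bound, and using first joins only gives a unique parent even if
  -- a vertex leaves and returns.
  let f : V → ℕ := fun v => sInf {τ | (σ v).cl τ = C}
  let E : V → V → Prop := fun u v => ∃ i, net.nbr u i = v ∧ (σ u).IsParentPort T (net.deg u) C i
  have hfmem : ∀ v, M v → (σ v).cl (f v) = C := fun v hv =>
    Nat.sInf_mem (s := {τ | (σ v).cl τ = C}) ⟨_, hv.2.choose_spec.2⟩
  have hfle : ∀ v τ, (σ v).cl τ = C → f v ≤ τ := fun v τ hτ =>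
    Nat.sInf_le (s := {τ | (σ v).cl τ = C}) hτ
  have hfT : ∀ v, M v → f v ≤ T := fun v ⟨_, τ, hτ, e⟩ => (hfle v τ e).trans hτ
  have hE : ∀ u v, E u v → M u ∧ M v ∧ f v < f u ∧ net.graph.Adj u v ∧
      (finPort (net.deg u) ((σ u).pt (f u))).map (net.nbr u) = some v := by
    rintro u v ⟨i, rfl, τ, hτ, ⟨hp, hfirst⟩, rfl⟩
    have hmv := h.move u τ hτ i hp
    have hfr := h.free u τ hτ i hp
    have hMu : M u := ⟨hfr.1, τ + 1, hτ, rfl⟩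
    have hfu : f u = τ + 1 := by
      refine le_antisymm (hfle u _ rfl) ?_
      by_contra hlt
      exact hfirst (f u) (by omega) (hfmem u hMu)
    refine ⟨hMu, ⟨hfr.2, τ, hτ.le, hmv⟩, ?_, net.adj_nbr u i, ?_⟩
    · have := hfle _ τ hmv
      omega
    · rw [hfu, hp, Option.map_some]
  have hpar : ∀ v, M v → f v ≠ 0 → ∃ u, E v u := by
    intro v hv h0
    obtain ⟨τ, hτ⟩ := Nat.exists_eq_succ_of_ne_zero h0
    have hτT : τ < T := by have := hfT v hv; omega
    have hcl : (σ v).cl (τ + 1) = C := by have := hfmem v hv; rwa [hτ] at this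
    have hfirst : ∀ τ' ≤ τ, (σ v).cl τ' ≠ (σ v).cl (τ + 1) := by
      intro τ' hτ' e
      have := hfle v τ' (e.trans hcl)
      omega
    cases ho : finPort (net.deg v) ((σ v).pt (τ + 1)) with
    | none => exact absurd (h.stay v τ hτT ho).symm (hfirst τ le_rfl)
    | some i => exact ⟨net.nbr v i, i, rfl, τ, hτT, ⟨ho, hfirst⟩, hcl⟩
  -- A vertex with minimal first time has no parent, so its time is 0. Then its identifier is C,
  -- which also makes it unique.
  obtain ⟨r, hr, hr0⟩ : ∃ r, M r ∧ f r = 0 := by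
    obtain ⟨v, hv⟩ := hne
    obtain ⟨r, hr, hmin⟩ := Set.exists_min_image {v | M v} f (Set.toFinite _) ⟨v, (hg1 v C).1 hv⟩
    refine ⟨r, hr, ?_⟩
    by_contra h0
    obtain ⟨u, hu⟩ := hpar r hr h0
    have := hE r u hu
    exact absurd (hmin u this.2.1) (by omega)
  have hroot : ∀ v, M v → f v = 0 → v = r := by
    intro v hv h0
    have h1 := hfmem v hv
    have h2 := hfmem r hr
    rw [h0, h.zero] at h1
    rw [hr0, h.zero] at h2
    exact net.ident_injective (h1.trans h2.symm)
  let S : net.graph.Subgraph :=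
    { verts := {v | M v}
      Adj := fun u v => E u v ∨ E v u
      adj_sub := by
        rintro u v (e | e)
        · exact (hE u v e).2.2.2.1
        · exact (hE v u e).2.2.2.1.symm
      edge_vert := by
        rintro u v (e | e)
        · exact (hE u v e).1
        · exact (hE v u e).2.1
      symm := ⟨fun u v e => e.symm⟩ }
  have hchoice : ∀ v : S.verts, ∃ u : S.verts, f v ≠ 0 → E v u := by
    rintro ⟨v, hv⟩
    by_cases h0 : f v = 0
    · exact ⟨⟨v, hv⟩, fun h => absurd h0 h⟩
    · obtain ⟨u, hu⟩ := hpar v hv h0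
      exact ⟨⟨u, (hE v u hu).2.1⟩, fun _ => hu⟩
  choose p hp using hchoice
  have hne0 : ∀ v : S.verts, v ≠ ⟨r, hr⟩ → f v ≠ 0 := fun v hv h0 =>
    hv (Subtype.ext (hroot v v.2 h0))
  have huniq : ∀ u v w, E u v → E u w → v = w := by
    intro u v w h1 h2
    have e1 := (hE u v h1).2.2.2.2
    have e2 := (hE u w h2).2.2.2.2
    exact Option.some.inj (e1.symm.trans e2)
  have hEne : ∀ u v : S.verts, E u v → u ≠ ⟨r, hr⟩ ∧ p u = v := by
    intro u v e
    have hlt := (hE u v e).2.2.1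
    refine ⟨?_, Subtype.ext (huniq u _ _ (hp u (by omega)) e)⟩
    rintro rfl
    rw [hr0] at hlt
    omega
  obtain ⟨ht, hd⟩ := isTree_of_parent S.coe ⟨r, hr⟩ p (fun v => f v)
    (fun v hv => ⟨Or.inl (hp v (hne0 v hv)), (hE _ _ (hp v (hne0 v hv))).2.2.1⟩)
    (by
      rintro u v (e | e)
      · exact Or.inl (hEne u v e)
      · exact Or.inr (hEne v u e))
  refine ⟨S, ⟨r, hr⟩, fun v => (hg1 v C).symm, fun v i => ?_, ht, fun v => (hd v).trans ?_⟩
  · rw [hg2 v C i]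
    refine or_congr ?_ ?_
    · constructor
      · rintro ⟨i', e, hi'⟩
        obtain rfl : i' = i := (net.port v).injective (Subtype.ext e)
        exact hi'
      · exact fun hi => ⟨i, rfl, hi⟩
    · constructor
      · rintro ⟨i', e, hi'⟩
        obtain rfl : i' = net.backPort v i := (net.port _).injective
          (Subtype.ext (e.trans (net.nbr_backPort v i).symm))
        exact hi'
      · exact fun hi => ⟨net.backPort v i, net.nbr_backPort v i, hi⟩
  · exact_mod_cast hfT v v.2

end

/-! ### Assembling phases and colors -/

/-- Vertices that already have an output start dead: they neither propose nor receive proposals.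
They continue to run the program but do not affect the new clusters. -/
def St.startColor {b : ℕ} (s : St b) : St b :=
  { s with
    alive := s.out.isNone
    cl := fun _ => s.id
    pt := fun _ => none
    lev := 0
    tok := 1
    stl := false }

def St.endPhase {b : ℕ} (s : St b) : St b :=
  { s with
    lev := if s.stl then min (s.lev + 1) b else s.lev
    stl := Decidable.decide (b ≤ if s.stl then min (s.lev + 1) b else s.lev) }

def St.finishColor {b : ℕ} (j T : ℕ) (s : St b) : St b :=
  if s.alive then { s with out := some (j, s.cl T) } else s

/-- The number of phases of the construction of the clusters of one color. -/
def numPhases (b : ℕ) : ℕ := 4 * b + 4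

/-- The number of tokens that a cluster pays for each vertex that it kills. -/
def price (b : ℕ) : ℕ := 2 * (3 * numPhases b + 2)

/-- The number of steps of the construction of the clusters of one color. -/
def numSteps (b : ℕ) : ℕ := numPhases b * (2 * price b)

noncomputable def growProg {b : ℕ} (Y t s : ℕ) : List (Round (St b) (Msg b)) :=
  (List.range s).flatMap fun τ => stepProg Y (t + τ)

noncomputable def phasesProg {b : ℕ} (Y p : ℕ) : List (Round (St b) (Msg b)) :=
  (List.range p).flatMap fun i => growProg Y (i * (2 * Y)) (2 * Y) ++
    [localRound fun _ => St.endPhase]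

noncomputable def colorProg (b j : ℕ) : List (Round (St b) (Msg b)) :=
  localRound (fun _ => St.startColor) :: (phasesProg (price b) (numPhases b) ++
    (treeProg j (numSteps b) ++ [localRound fun _ => St.finishColor j (numSteps b)]))

noncomputable def fullProg (b k : ℕ) : List (Round (St b) (Msg b)) :=
  (List.range k).flatMap (colorProg b)

section

variable {V : Type} {b : ℕ} {net : Network V b}

/-- The properties of the part of the output that belongs to the color `j`. -/
structure ColorGood (net : Network V b) (j D M : ℕ) (σ : V → St b) : Prop where
  sep : ∀ u v C C', net.graph.Adj u v → (σ u).out = some (j, C) → (σ v).out = some (j, C') → C = C'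
  tree : ∀ C, (∃ v, (σ v).out = some (j, C)) → ∃ (S : net.graph.Subgraph) (r : S.verts),
    (∀ v, v ∈ S.verts ↔ ((σ v).tr j C).isSome) ∧
    (∀ v i, S.Adj v (net.nbr v i) ↔ ∃ s, (σ v).tr j C = some s ∧ (i : ℕ) ∈ s) ∧
    S.coe.IsTree ∧ (∀ v, S.coe.edist r v ≤ D) ∧ ∀ v, (σ v).out = some (j, C) → v ∈ S.verts
  cong : ∀ v, {C | ((σ v).tr j C).isSome}.ncard ≤ M

theorem ColorGood.congr {j D M : ℕ} {σ σ' : V → St b} (h : ColorGood net j D M σ)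
    (hout : ∀ v C, (σ' v).out = some (j, C) ↔ (σ v).out = some (j, C))
    (htr : ∀ v, (σ' v).tr j = (σ v).tr j) : ColorGood net j D M σ' := by
  obtain ⟨h1, h2, h3⟩ := h
  constructor
  · simpa only [hout] using h1
  · simpa only [hout, htr] using h2
  · simpa only [htr] using h3

/-- A vertex visits its initial cluster and at most one more per move. Via the bound on moves this
controls the overlap of the Steiner trees. -/
theorem Hist.ncard_clusters_le {T : ℕ} {σ : V → St b} (h : Hist net T σ) (v : V) :
    {C | ∃ τ ≤ T, (σ v).cl τ = C}.ncard ≤ ((Finset.range T).filter fun τ =>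
      (finPort (net.deg v) ((σ v).pt (τ + 1))).isSome = true).card + 1 := by
  classical
  set F := (Finset.range T).filter fun τ =>
    (finPort (net.deg v) ((σ v).pt (τ + 1))).isSome = true with hF
  have key : ∀ τ ≤ T, (σ v).cl τ ∈ insert ((σ v).cl 0) (F.image fun τ => (σ v).cl (τ + 1)) := by
    intro τ hτ
    induction τ with
    | zero => exact Finset.mem_insert_self _ _
    | succ τ ih =>
      cases ho : finPort (net.deg v) ((σ v).pt (τ + 1)) with
      | none => rw [h.stay v τ hτ ho]; exact ih (by omega)
      | some i =>
        refine Finset.mem_insert_of_mem (Finset.mem_image.2 ⟨τ, ?_, rfl⟩)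
        rw [hF, Finset.mem_filter, Finset.mem_range, ho]
        exact ⟨hτ, rfl⟩
  have hsub : {C | ∃ τ ≤ T, (σ v).cl τ = C} ⊆
      (insert ((σ v).cl 0) (F.image fun τ => (σ v).cl (τ + 1)) : Finset (BitVec b)) := by
    rintro C ⟨τ, hτ, rfl⟩
    exact key τ hτ
  refine (Set.ncard_le_ncard hsub (Finset.finite_toSet _)).trans ?_
  rw [Set.ncard_coe_finset]
  exact (Finset.card_insert_le _ _).trans (Nat.add_le_add_right Finset.card_image_le 1)

variable [Fintype V] {ρ : BitVec b → V}

/-- The vertices without output. -/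
def todo (σ : V → St b) : Finset V := Finset.univ.filter fun v => (σ v).out = none

/-- The situation after `i` phases and `s` steps of the next one, at time `t`, of a computation that
started with the states `σ₀`. -/
structure Running (net : Network V b) (ρ : BitVec b → V) (Y i s t : ℕ) (σ₀ σ : V → St b) : Prop where
  hist : Hist net t σ
  inv : (toCfg net ρ t σ).Inv net.graph net.ident Y (todo σ₀) i s
  out : ∀ v, (σ v).out = (σ₀ v).out
  tr : ∀ v, (σ v).tr = (σ₀ v).tr

variable {Y i s t : ℕ} {σ₀ σ : V → St b}

theorem Running.start (hb : 0 < b) (hρ : ∀ v, ρ (net.ident v) = v)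
    (hid : ∀ v, (σ₀ v).id = net.ident v) :
    Running net ρ Y 0 0 0 σ₀ (fun v => (σ₀ v).startColor) where
  hist := ⟨hid, hid, by simp, by simp, by simp⟩
  out _ := rfl
  tr _ := rfl
  inv :=
    { alive_mem := fun v hv => by simpa [toCfg, St.startColor, todo] using hv
      cl_mem := fun v hv => by simpa [toCfg, St.startColor, hid, hρ] using hv
      lev_le := fun C => Nat.zero_le _
      lev_lt := fun C _ => hb
      agree := fun u v _ _ _ k hk => absurd hk (Nat.not_lt_zero _)
      stalled := fun u v _ _ _ hs => by simp [toCfg, St.startColor] at hs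
      mov_le := fun v => by
        have := rankOf_le (net.ident v) 0
        simpa [toCfg, St.startColor, Cfg.rank, hid, hρ] using this
      tokens := by
        have : (todo σ₀).filter (fun v => (toCfg net ρ 0 fun v => (σ₀ v).startColor).alive v = false)
            = ∅ := by
          rw [Finset.filter_eq_empty_iff]
          intro v hv
          have := (Finset.mem_filter.1 hv).2
          simp [toCfg, St.startColor, this]
        rw [this]
        simp [toCfg, St.startColor]
      growing := fun C _ => by simp [toCfg, St.startColor]
      resting := fun C _ hs => by simp [toCfg, St.startColor] at hs }

variable [DecidableEq V]

theorem Running.step (hρ : ∀ v, ρ (net.ident v) = v) (hcard : Fintype.card V ≤ 2 ^ b) (hY : 0 < Y)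
    (h : Running net ρ Y i s t σ₀ σ) :
    Running net ρ Y i (s + 1) (t + 1) σ₀ (runAll net (stepProg Y t) σ) := by
  obtain ⟨tgt, h1, h2, h3, h4⟩ := runAll_stepProg hρ hcard h.hist h.inv.lev_le (fun v hv => by
    rw [h.out]
    exact (Finset.mem_filter.1 (h.inv.alive_mem v hv)).2) Y
  refine ⟨h3, ?_, fun v => (h4 v).1.trans (h.out v), fun v => (h4 v).2.trans (h.tr v)⟩
  rw [h2]
  exact h.inv.step hY h1

theorem Running.grow (hρ : ∀ v, ρ (net.ident v) = v) (hcard : Fintype.card V ≤ 2 ^ b) (hY : 0 < Y)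
    (h : Running net ρ Y i 0 t σ₀ σ) (s : ℕ) :
    Running net ρ Y i s (t + s) σ₀ (runAll net (growProg Y t s) σ) := by
  induction s with
  | zero => exact h
  | succ s ih =>
    rw [growProg, List.range_succ, List.flatMap_append, runAll_append, ← growProg,
      List.flatMap_singleton]
    exact ih.step hρ hcard hY

theorem Running.phases (hρ : ∀ v, ρ (net.ident v) = v) (hcard : Fintype.card V ≤ 2 ^ b)
    (hY : 0 < Y) (h : Running net ρ Y 0 0 0 σ₀ σ) (p : ℕ) :
    Running net ρ Y p 0 (p * (2 * Y)) σ₀ (runAll net (phasesProg Y p) σ) := by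
  induction p with
  | zero => simpa [phasesProg] using h
  | succ p ih =>
    rw [phasesProg, List.range_succ, List.flatMap_append, runAll_append, ← phasesProg,
      List.flatMap_singleton, runAll_append]
    obtain ⟨h1, h2, h3, h4⟩ := ih.grow hρ hcard hY (2 * Y)
    rw [show (p + 1) * (2 * Y) = p * (2 * Y) + 2 * Y by ring]
    exact ⟨⟨h1.id_eq, h1.zero, h1.stay, h1.move, h1.free⟩, h2.endPhase hY, h3, h4⟩

/-- The effect of the program for one color. -/
theorem runAll_colorProg (hcard : Fintype.card V ≤ 2 ^ b) (hb : 0 < b) (j : ℕ)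
    (hid : ∀ v, (σ v).id = net.ident v) (hj : ∀ v C, (σ v).out ≠ some (j, C)) :
    (∀ v, (runAll net (colorProg b j) σ v).id = net.ident v) ∧
    (∀ v, ∀ l ≠ j, (runAll net (colorProg b j) σ v).tr l = (σ v).tr l) ∧
    (∀ v x, (σ v).out = some x → (runAll net (colorProg b j) σ v).out = some x) ∧
    (∀ v x, (σ v).out = none → (runAll net (colorProg b j) σ v).out = some x → x.1 = j) ∧
    2 * (todo (runAll net (colorProg b j) σ)).card ≤ (todo σ).card ∧
    ColorGood net j (numSteps b) (3 * numPhases b + 2) (runAll net (colorProg b j) σ) := by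
  rcases isEmpty_or_nonempty V with hV | hV
  · refine ⟨isEmptyElim, isEmptyElim, isEmptyElim, isEmptyElim, ?_, isEmptyElim, ?_, isEmptyElim⟩
    · simp [todo, Finset.univ_eq_empty]
    · rintro C ⟨v, -⟩
      exact isEmptyElim v
  have hρ : ∀ v, Function.invFun net.ident (net.ident v) = v :=
    Function.leftInverse_invFun net.ident_injective
  have hY : 0 < price b := by unfold price; omega
  obtain ⟨h1, h2, h3, h4⟩ :=
    (Running.start (σ₀ := σ) (Y := price b) hb hρ hid).phases hρ hcard hY (numPhases b)
  rw [← numSteps] at h1 h2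
  set σ₁ := runAll net (phasesProg (price b) (numPhases b)) fun v => (σ v).startColor with hσ₁
  obtain ⟨g, hg, hg1, hg2⟩ := runAll_treeProg h1 j
  have hrun : runAll net (colorProg b j) σ = fun v =>
      St.finishColor j (numSteps b) { σ₁ v with tr := Function.update (σ₁ v).tr j (g v) } := by
    rw [colorProg, runAll_cons, runAll_append, runAll_append,
      show (localRound fun _ => St.startColor).run net σ = fun v => (σ v).startColor from rfl, ← hσ₁,
      hg]
    rfl
  have hfree : ∀ v, (σ₁ v).alive = true → (σ v).out = none := fun v hv =>
    (Finset.mem_filter.1 (h2.alive_mem v hv)).2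
  have hout1 : ∀ v, (σ₁ v).alive = true →
      (runAll net (colorProg b j) σ v).out = some (j, (σ₁ v).cl (numSteps b)) := by
    intro v hv
    rw [hrun]
    simp [St.finishColor, hv]
  have hout2 : ∀ v, (σ₁ v).alive = false → (runAll net (colorProg b j) σ v).out = (σ v).out := by
    intro v hv
    rw [hrun]
    simp [St.finishColor, hv, h3]
  have htr : ∀ v, (runAll net (colorProg b j) σ v).tr = Function.update (σ v).tr j (g v) := by
    intro v
    rw [hrun]
    simp only [St.finishColor]
    split <;> simp [h4]
  have hout3 : ∀ v C, (runAll net (colorProg b j) σ v).out = some (j, C) →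
      (σ₁ v).alive = true ∧ (σ₁ v).cl (numSteps b) = C := by
    intro v C hv
    cases ha : (σ₁ v).alive with
    | false => exact absurd (hout2 v ha ▸ hv) (hj v C)
    | true => simpa [hout1 v ha] using hv
  refine ⟨fun v => ?_, fun v l hl => ?_, fun v x hx => ?_, fun v x hx hx' => ?_, ?_, ?_, ?_, ?_⟩
  · rw [hrun]
    simp only [St.finishColor]
    split <;> exact h1.id_eq v
  · rw [htr, Function.update_of_ne hl]
  · cases ha : (σ₁ v).alive with
    | false => rw [hout2 v ha, hx]
    | true => simp [hfree v ha] at hx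
  · cases ha : (σ₁ v).alive with
    | false => simp [hout2 v ha, hx] at hx'
    | true =>
      rw [hout1 v ha] at hx'
      cases hx'
      rfl
  · have hdead := h2.two_mul_card_dead_le
    refine le_trans (Nat.mul_le_mul_left 2 (Finset.card_le_card ?_)) hdead
    intro v hv
    have hv := (Finset.mem_filter.1 hv).2
    have ha : (σ₁ v).alive = false := by
      by_contra ha
      rw [hout1 v (by simpa using ha)] at hv
      cases hv
    rw [hout2 v ha] at hv
    exact Finset.mem_filter.2 ⟨Finset.mem_filter.2 ⟨Finset.mem_univ _, hv⟩, ha⟩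
  · intro u v C C' huv hu hv
    obtain ⟨hau, rfl⟩ := hout3 u C hu
    obtain ⟨hav, rfl⟩ := hout3 v C' hv
    -- All clusters are now at level b, so agreement below the levels covers all bits and the two
    -- identifiers coincide.
    have hA : (todo σ).card ≤ 2 ^ b := (Finset.card_le_univ _).trans hcard
    have hl : ∀ w, (σ₁ w).alive = true → (toCfg net (Function.invFun net.ident) (numSteps b) σ₁).lev
        ((toCfg net (Function.invFun net.ident) (numSteps b) σ₁).cl w) = b := fun w hw =>
      h2.lev_eq hA hY (h2.cl_mem w (h2.alive_mem w hw))
    rw [← h1.ident_root hρ u le_rfl, ← h1.ident_root hρ v le_rfl]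
    refine BitVec.eq_of_getLsbD_eq fun k hk => ?_
    exact h2.agree u v huv hau hav k (by rw [hl u hau]; exact hk) (by rw [hl v hav]; exact hk)
  · rintro C ⟨w, hw⟩
    have hmem : ∀ v, (runAll net (colorProg b j) σ v).out = some (j, C) → (g v C).isSome := by
      intro v hv
      obtain ⟨ha, e⟩ := hout3 v C hv
      exact (hg1 v C).2 ⟨(h3 v).trans (hfree v ha), _, le_rfl, e⟩
    obtain ⟨S, r, a1, a2, a3, a4⟩ := hg2 C ⟨w, hmem w hw⟩
    refine ⟨S, r, ?_, ?_, a3, a4, fun v hv => (a1 v).2 (hmem v hv)⟩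
    · simpa [htr] using a1
    · simpa [htr] using a2
  · intro v
    have hsub : {C | ((runAll net (colorProg b j) σ v).tr j C).isSome} ⊆
        {C | ∃ τ ≤ numSteps b, (σ₁ v).cl τ = C} := by
      intro C hC
      rw [Set.mem_ofPred_eq, htr, Function.update_self, hg1] at hC
      exact hC.2
    refine (Set.ncard_le_ncard hsub (Set.toFinite _)).trans ((h1.ncard_clusters_le v).trans ?_)
    have := h2.mov_lt v
    simp only [toCfg] at this
    omega

/-- After the programs for `k` colors, the fraction of vertices without output is at most
`1 / 2 ^ k`. -/
theorem runAll_fullProg (hcard : Fintype.card V ≤ 2 ^ b) (hb : 0 < b)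
    (hid : ∀ v, (σ v).id = net.ident v) (hout : ∀ v, (σ v).out = none) (k : ℕ) :
    (∀ v, (runAll net (fullProg b k) σ v).id = net.ident v) ∧
    (∀ v x, (runAll net (fullProg b k) σ v).out = some x → x.1 < k) ∧
    2 ^ k * (todo (runAll net (fullProg b k) σ)).card ≤ Fintype.card V ∧
    ∀ j < k, ColorGood net j (numSteps b) (3 * numPhases b + 2) (runAll net (fullProg b k) σ) := by
  induction k with
  | zero =>
    refine ⟨hid, fun v x hx => ?_, ?_, by simp⟩
    · simp [fullProg, hout] at hx
    · simpa using Finset.card_le_univ _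
  | succ k ih =>
    obtain ⟨h1, h2, h3, h4⟩ := ih
    rw [fullProg, List.range_succ, List.flatMap_append, runAll_append, ← fullProg,
      List.flatMap_singleton]
    obtain ⟨a1, a2, a3, a4, a5, a6⟩ := runAll_colorProg hcard hb k h1
      (fun v C hC => absurd (h2 v _ hC) (lt_irrefl _))
    refine ⟨a1, fun v x hx => ?_, ?_, fun j hj => ?_⟩
    · cases ho : (runAll net (fullProg b k) σ v).out with
      | none => exact (a4 v x ho hx).trans_lt k.lt_succ_self
      | some y =>
        rw [a3 v y ho] at hx
        cases hx
        exact (h2 v _ ho).trans k.lt_succ_self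
    · refine le_trans ?_ h3
      rw [pow_succ, mul_assoc]
      exact Nat.mul_le_mul_left _ a5
    · rcases (Nat.lt_succ_iff.1 hj).eq_or_lt with rfl | hlt
      · exact a6
      · refine (h4 j hlt).congr (fun v C => ⟨fun hv => ?_, a3 v _⟩) fun v => a2 v j hlt.ne
        cases ho : (runAll net (fullProg b k) σ v).out with
        | none => exact absurd (a4 v _ ho hv) hlt.ne
        | some y => rw [a3 v y ho] at hv; exact hv

end

/-! ### Round counts -/

theorem growProg_length_le {b : ℕ} (Y t s : ℕ) :
    (growProg (b := b) Y t s).length ≤ s * (3 * (t + s) + 6) := by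
  rw [growProg, List.length_flatMap]
  refine (List.sum_le_card_nsmul _ (3 * (t + s) + 6) ?_).trans (by simp)
  simp only [List.mem_map, List.mem_range, stepProg_length, forall_exists_index, and_imp]
  rintro _ τ hτ rfl
  omega

theorem phasesProg_length_le {b : ℕ} (Y p : ℕ) :
    (phasesProg (b := b) Y p).length ≤ p * (2 * Y * (3 * (p * (2 * Y)) + 6) + 1) := by
  rw [phasesProg, List.length_flatMap]
  refine (List.sum_le_card_nsmul _ (2 * Y * (3 * (p * (2 * Y)) + 6) + 1) ?_).trans (by simp)
  simp only [List.mem_map, List.mem_range, forall_exists_index, and_imp, List.length_append,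
    List.length_singleton]
  rintro _ i hi rfl
  refine Nat.add_le_add_right ((growProg_length_le _ _ _).trans (Nat.mul_le_mul_left _ ?_)) 1
  have : (i + 1) * (2 * Y) ≤ p * (2 * Y) := Nat.mul_le_mul_right _ hi
  rw [add_one_mul] at this
  omega

theorem numPhases_le {b : ℕ} (hb : 0 < b) : numPhases b ≤ 8 * b := by
  unfold numPhases; omega

theorem price_le {b : ℕ} (hb : 0 < b) : price b ≤ 52 * b := by
  unfold price numPhases; omega

theorem numSteps_le {b : ℕ} (hb : 0 < b) : numSteps b ≤ 832 * b ^ 2 := by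
  calc numSteps b ≤ 8 * b * (2 * (52 * b)) :=
        Nat.mul_le_mul (numPhases_le hb) (Nat.mul_le_mul_left _ (price_le hb))
    _ = 832 * b ^ 2 := by ring

/-- A step at time t takes O(t + 1) rounds and a color has O(b²) steps, hence O(b⁴) rounds per
color; the b + 1 colors give the fifth power. -/
theorem fullProg_length_le {b : ℕ} (hb : 0 < b) :
    (fullProg b (b + 1)).length ≤ 10000000 * b ^ 5 := by
  have hc : ∀ j, (colorProg b j).length ≤ 2082507 * b ^ 4 := by
    intro j
    rw [colorProg, List.length_cons, List.length_append, List.length_append, treeProg_length,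
      List.length_singleton]
    have h1 := phasesProg_length_le (b := b) (price b) (numPhases b)
    have h2 := numSteps_le hb
    have h3 : numPhases b * (2 * price b * (3 * (numPhases b * (2 * price b)) + 6) + 1) ≤
        8 * b * (2 * (52 * b) * (3 * (832 * b ^ 2) + 6) + 1) := by
      have := price_le hb
      have := numPhases_le hb
      rw [← numSteps]
      gcongr
    have h4 : 8 * b * (2 * (52 * b) * (3 * (832 * b ^ 2) + 6) + 1) =
        2076672 * b ^ 4 + 4992 * b ^ 2 + 8 * b := by ring
    have p1 : b ≤ b ^ 4 := Nat.le_self_pow (by norm_num) b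
    have p2 : b ^ 2 ≤ b ^ 4 := Nat.pow_le_pow_right hb (by norm_num)
    have p3 : 1 ≤ b ^ 4 := Nat.one_le_pow _ _ hb
    omega
  rw [fullProg, List.length_flatMap]
  refine (List.sum_le_card_nsmul _ (2082507 * b ^ 4) ?_).trans ?_
  · simp only [List.mem_map, forall_exists_index, and_imp]
    rintro _ j - rfl
    exact hc j
  · simp only [List.length_map, List.length_range, smul_eq_mul]
    calc (b + 1) * (2082507 * b ^ 4) ≤ (b + b) * (2082507 * b ^ 4) := by gcongr; omega
      _ = 4165014 * b ^ 5 := by ring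
      _ ≤ 10000000 * b ^ 5 := by gcongr; norm_num

/-! ### Outputs and the final bounds -/

def St.initial {b : ℕ} (x : BitVec b) : St b where
  id := x
  alive := false
  cl _ := x
  pt _ := none
  lev := 0
  tok := 1
  stl := false
  acc _ := 0
  know _ := (0, false)
  out := none
  tr _ _ := none

/-- The output of a vertex of degree `d`. The name of a cluster encodes its color and its
identifier. -/
def St.output {b : ℕ} (d : ℕ) (s : St b) : NodeOutput d where
  cluster := (s.out.map fun x => Nat.pair x.1 x.2.toNat).getD 0
  color := (s.out.map Prod.fst).getD 0
  tree k := (s.tr k.unpair.1 (BitVec.ofNat b k.unpair.2)).map fun S =>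
    Finset.univ.filter fun i : Fin d => (i : ℕ) ∈ S

theorem pair_toNat_inj {b j j' : ℕ} {C C' : BitVec b}
    (h : Nat.pair j C.toNat = Nat.pair j' C'.toNat) : j = j' ∧ C = C' := by
  rw [Nat.pair_eq_pair] at h
  exact ⟨h.1, BitVec.eq_of_toNat_eq h.2⟩

theorem edist_hom_le {W W' : Type} {H : SimpleGraph W} {H' : SimpleGraph W'} (f : H →g H') (u v : W) :
    H'.edist (f u) (f v) ≤ H.edist u v := by
  by_cases h : H.edist u v = ⊤
  · rw [h]
    exact le_top
  · obtain ⟨w, hw⟩ := SimpleGraph.exists_walk_of_edist_ne_top h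
    rw [← hw, ← SimpleGraph.Walk.length_map f w]
    exact SimpleGraph.edist_le _

theorem card_le_two_pow {V : Type} [Fintype V] {b : ℕ} (net : Network V b) :
    Fintype.card V ≤ 2 ^ b := by
  have h : Fintype.card (BitVec b) = 2 ^ b := by
    rw [Fintype.card_congr BitVec.equivFin.toEquiv, Fintype.card_fin]
  exact h ▸ Fintype.card_le_of_injective _ net.ident_injective

/-- The final states of the vertices. -/
noncomputable def finalState {V : Type} {b : ℕ} (net : Network V b) : V → St b :=
  runAll net (fullProg b (b + 1)) fun v => St.initial (net.ident v)

section

variable {V : Type} {b : ℕ} (net : Network V b)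

theorem output_eq {v : V} {j : ℕ} {C : BitVec b} (h : (finalState net v).out = some (j, C)) :
    ((finalState net v).output (net.deg v)).cluster = Nat.pair j C.toNat ∧
    ((finalState net v).output (net.deg v)).color = j := by
  simp [St.output, h]

variable [Fintype V]

/-- An unassigned vertex after b + 1 halvings would force 2^(b+1) ≤ n ≤ 2^b. -/
theorem exists_out (hb : 0 < b) (v : V) :
    ∃ j C, (finalState net v).out = some (j, C) ∧ j < b + 1 ∧
      ColorGood net j (numSteps b) (3 * numPhases b + 2) (finalState net) := by
  classical
  obtain ⟨-, h2, h3, h4⟩ := runAll_fullProg (net := net) (card_le_two_pow net) hb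
    (σ := fun v => St.initial (net.ident v)) (fun _ => rfl) (fun _ => rfl) (b + 1)
  have hempty : todo (finalState net) = ∅ := by
    rw [← Finset.card_eq_zero]
    by_contra h0
    have h5 : 2 ^ (b + 1) * 1 ≤ 2 ^ b :=
      (Nat.mul_le_mul_left _ (Nat.one_le_iff_ne_zero.2 h0)).trans (h3.trans (card_le_two_pow net))
    have : 0 < 2 ^ b := by positivity
    rw [pow_succ] at h5
    omega
  cases ho : (finalState net v).out with
  | none =>
    have : v ∈ todo (finalState net) := Finset.mem_filter.2 ⟨Finset.mem_univ _, ho⟩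
    rw [hempty] at this
    cases this
  | some x => exact ⟨x.1, x.2, rfl, h2 v x ho, h4 _ (h2 v x ho)⟩

/-- The Steiner tree of the cluster named `k`. -/
theorem exists_steinerTree (hb : 0 < b) (k : ℕ)
    (hk : k ∈ Set.range fun v => ((finalState net v).output (net.deg v)).cluster) :
    ∃ T : net.graph.Subgraph,
      Describes net (fun v => (finalState net v).output (net.deg v)) k T ∧
      IsSteinerTree T {v | ((finalState net v).output (net.deg v)).cluster = k} ∧
      ∃ r : T.verts, ∀ v, T.coe.edist r v ≤ numSteps b := by
  obtain ⟨v, rfl⟩ := hk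
  obtain ⟨j, C, hout, -, hgood⟩ := exists_out net hb v
  obtain ⟨T, r, h1, h2, h3, h4, h5⟩ := hgood.tree C ⟨v, hout⟩
  have htree : ∀ u, ((finalState net u).output (net.deg u)).tree (Nat.pair j C.toNat) =
      ((finalState net u).tr j C).map fun S =>
        Finset.univ.filter fun i : Fin (net.deg u) => (i : ℕ) ∈ S := by
    intro u
    simp [St.output]
  simp only [(output_eq net hout).1]
  refine ⟨T, ⟨fun u => ?_, fun u i => ?_⟩, ⟨h3, fun u hu => ?_⟩, r, h4⟩
  · rw [h1, htree, Option.isSome_map]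
  · rw [h2, htree]
    constructor
    · rintro ⟨s, hs, hi⟩
      exact ⟨_, by rw [hs, Option.map_some], by simpa using hi⟩
    · rintro ⟨s, hs, hi⟩
      rw [Option.map_eq_some_iff] at hs
      obtain ⟨s', hs', rfl⟩ := hs
      exact ⟨s', hs', by simpa using hi⟩
  · obtain ⟨j', C', hout', -⟩ := exists_out net hb u
    have hu : ((finalState net u).output (net.deg u)).cluster = Nat.pair j C.toNat := hu
    rw [(output_eq net hout').1] at hu
    obtain ⟨rfl, rfl⟩ := pair_toNat_inj hu
    exact h5 u hout'

theorem isNetworkDecomposition_finalState (hb : 0 < b) :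
    IsNetworkDecomposition net.graph
      (fun v => ((finalState net v).output (net.deg v)).cluster)
      (fun v => ((finalState net v).output (net.deg v)).color) (b + 1) (2 * numSteps b) where
  color_eq u v h := by
    obtain ⟨j, C, hu, -⟩ := exists_out net hb u
    obtain ⟨j', C', hv, -⟩ := exists_out net hb v
    simp only [output_eq net hu, output_eq net hv] at h ⊢
    exact (pair_toNat_inj h).1
  color_lt v := by
    obtain ⟨j, C, hv, hlt, -⟩ := exists_out net hb v
    simpa only [output_eq net hv] using hlt
  color_ne u v huv h := by
    obtain ⟨j, C, hu, -, hgood⟩ := exists_out net hb u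
    obtain ⟨j', C', hv, -⟩ := exists_out net hb v
    simp only [output_eq net hu, output_eq net hv] at h ⊢
    rintro rfl
    exact h (by rw [hgood.sep u v C C' huv hu hv])
  weak_diam u v h := by
    obtain ⟨T, -, ⟨-, hT⟩, r, hr⟩ := exists_steinerTree net hb _ ⟨u, rfl⟩
    have e : ∀ w, ((finalState net w).output (net.deg w)).cluster =
        ((finalState net u).output (net.deg u)).cluster → net.graph.edist r w ≤ numSteps b :=
      -- Distances in the Steiner tree bound those in the graph; going through its root gives twice
      -- the depth.
      fun w hw => (edist_hom_le T.hom r ⟨w, hT hw⟩).trans (hr ⟨w, hT hw⟩)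
    calc net.graph.edist u v ≤ net.graph.edist u r + net.graph.edist r v :=
          SimpleGraph.edist_triangle
      _ ≤ numSteps b + numSteps b := by
          rw [SimpleGraph.edist_comm]
          exact add_le_add (e u rfl) (e v h.symm)
      _ = ((2 * numSteps b : ℕ) : ℕ∞) := by
          rw [two_mul, Nat.cast_add]

theorem ncard_trees_le (hb : 0 < b) (T : ℕ → net.graph.Subgraph)
    (hT : ∀ k ∈ Set.range fun v => ((finalState net v).output (net.deg v)).cluster,
      Describes net (fun v => (finalState net v).output (net.deg v)) k (T k)) (v : V) (j : ℕ) :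
    {k : ℕ | (∃ u, ((finalState net u).output (net.deg u)).cluster = k ∧
      ((finalState net u).output (net.deg u)).color = j) ∧ v ∈ (T k).verts}.ncard ≤
        3 * numPhases b + 2 := by
  by_cases hj : ∃ u C, (finalState net u).out = some (j, C)
  · obtain ⟨u, C, hu⟩ := hj
    obtain ⟨j', C', hu', -, hgood⟩ := exists_out net hb u
    obtain ⟨rfl, rfl⟩ : j' = j ∧ C' = C := by simpa [hu] using hu'.symm
    refine le_trans ?_ (hgood.cong v)
    refine le_trans (Set.ncard_le_ncard (t := (fun C : BitVec b => Nat.pair j' C.toNat) ''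
      {C | ((finalState net v).tr j' C).isSome}) ?_ (Set.toFinite _)) (Set.ncard_image_le (Set.toFinite _))
    rintro k ⟨⟨w, rfl, hw⟩, hv⟩
    obtain ⟨i, D, hD, -⟩ := exists_out net hb w
    rw [(hT _ ⟨w, rfl⟩).mem_verts] at hv
    rw [(output_eq net hD).2] at hw
    subst hw
    refine ⟨D, ?_, (output_eq net hD).1.symm⟩
    beta_reduce at hv
    rw [(output_eq net hD).1] at hv
    simpa [St.output] using hv
  -- A color that no vertex uses has no clusters. It needs its own case because `ColorGood` is
  -- available only for colors that occur.
  · refine le_trans (le_of_eq ?_) (Nat.zero_le _)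
    rw [Set.ncard_eq_zero (Set.Finite.subset (Set.finite_range _) fun k hk =>
      hk.1.imp fun u hu => hu.1), Set.eq_empty_iff_forall_notMem]
    rintro k ⟨⟨w, -, hw⟩, -⟩
    obtain ⟨i, D, hD, -⟩ := exists_out net hb w
    rw [(output_eq net hD).2] at hw
    exact hj ⟨w, D, hw ▸ hD⟩

end

/-- For every message size there is an algorithm that computes the final states. -/
theorem exists_algorithm (b B : ℕ) :
    ∃ A : Algorithm b B, 0 < B →
      A.rounds = (fullProg b (b + 1)).length * ((3 * b + 3) / B + 1 + 1) ∧
      ∀ (V : Type) (net : Network V b), A.result net =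
        fun v => (finalState net v).output (net.deg v) := by
  rcases Nat.eq_zero_or_pos B with rfl | hB
  -- A dummy for message size 0, which does not occur for n ≥ 2.
  · exact ⟨Algorithm.ofProgram (fun _ => St.initial) [] St.output, fun h => absurd h (lt_irrefl 0)⟩
  · have hle : Fintype.card (Msg b) ≤ 2 ^ (((3 * b + 3) / B + 1) * B) := by
      refine (card_msg_le b).trans (Nat.pow_le_pow_right (by norm_num) ?_)
      have := Nat.div_add_mod (3 * b + 3) B
      have := Nat.mod_lt (3 * b + 3) hB
      rw [add_one_mul, mul_comm _ B]
      omega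
    obtain ⟨A, h1, h2⟩ := exists_algorithm_of_program hle (fun _ => St.initial)
      (fullProg b (b + 1)) St.output
    exact ⟨A, fun _ => ⟨h1, fun V net => funext fun v => h2 V net v⟩⟩

end Congest

theorem mainTheorem1 (a β : ℝ) (c : ℕ) (hβ : 0 < β) :
    ∃ (K : ℝ) (A : ∀ N b : ℕ, Congest.Algorithm b ⌈β * Real.logb 2 N⌉₊),
      ∀ (V : Type) [Fintype V] (N b : ℕ) (net : Congest.Network V b),
        2 ≤ Fintype.card V →
        Fintype.card V ≤ N → N ≤ Fintype.card V ^ c →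
        (b : ℝ) ≤ a * Real.logb 2 (Fintype.card V) →
        ((A N b).rounds : ℝ) ≤ K * Real.logb 2 (Fintype.card V) ^ 5 ∧
        Congest.IsNetworkDecomposition net.graph
          (fun v => ((A N b).result net v).cluster) (fun v => ((A N b).result net v).color)
          ⌊K * Real.logb 2 (Fintype.card V)⌋₊ ⌊K * Real.logb 2 (Fintype.card V) ^ 2⌋₊ ∧
        ∃ T : ℕ → net.graph.Subgraph,
          (∀ k ∈ Set.range (fun v => ((A N b).result net v).cluster),
            Congest.Describes net ((A N b).result net) k (T k) ∧
            Congest.IsSteinerTree (T k) {v | ((A N b).result net v).cluster = k} ∧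
            (T k).coe.radius ≤ (⌊K * Real.logb 2 (Fintype.card V) ^ 2⌋₊ : ℕ)) ∧
          ∀ (v : V) (j : ℕ),
            (Set.ncard {k : ℕ | (∃ u, ((A N b).result net u).cluster = k ∧
                ((A N b).result net u).color = j) ∧ v ∈ (T k).verts} : ℝ) ≤
              K * Real.logb 2 (Fintype.card V) := by
  choose A hA using fun N b : ℕ => Congest.exists_algorithm b ⌈β * Real.logb 2 N⌉₊
  -- The factors come from the program length 10⁷ b⁵, from b ≤ (1 + |a|) log n, and from the rounds
  -- spent per message. Using 1 + |a| ≥ 1 lets the fifth power also dominate the lower powers in the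
  -- other bounds.
  refine ⟨10000000 * (1 + |a|) ^ 5 * (6 * |a| / β + 2), A, ?_⟩
  intro V _ N b net hn hN _ hab
  set K := 10000000 * (1 + |a|) ^ 5 * (6 * |a| / β + 2) with hK
  set L := Real.logb 2 (Fintype.card V) with hL
  have hL1 : 1 ≤ L := by
    rw [hL, Real.le_logb_iff_rpow_le (by norm_num) (by positivity), Real.rpow_one]
    exact_mod_cast hn
  have hL0 : 0 < L := by linarith
  have hLN : L ≤ Real.logb 2 N := by
    refine Real.logb_le_logb_of_le (by norm_num) (by positivity) ?_
    exact_mod_cast hN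
  have hb : 0 < b := by
    by_contra h0
    obtain rfl : b = 0 := by omega
    have := Congest.card_le_two_pow net
    omega
  have hB : 0 < ⌈β * Real.logb 2 N⌉₊ := Nat.ceil_pos.2 (mul_pos hβ (by linarith))
  obtain ⟨hrounds, hres⟩ := hA N b hB
  have hα : 1 ≤ 1 + |a| := by linarith [abs_nonneg a]
  have habs : (b : ℝ) ≤ |a| * L := hab.trans (mul_le_mul_of_nonneg_right (le_abs_self a) hL0.le)
  have hbL : (b : ℝ) ≤ (1 + |a|) * L := by linarith
  have hb1 : (1 : ℝ) ≤ b := by exact_mod_cast hb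
  have hq : 2 ≤ 6 * |a| / β + 2 := by
    have : 0 ≤ 6 * |a| / β := by positivity
    linarith
  have hKle : ∀ m ≤ 5, 20000000 * (1 + |a|) ^ m ≤ K := by
    intro m hm
    have h1 : (1 + |a|) ^ m ≤ (1 + |a|) ^ 5 := pow_le_pow_right₀ hα hm
    have h2 : 0 ≤ (1 + |a|) ^ 5 := by positivity
    rw [hK]
    nlinarith
  have hbnd : ∀ m ≤ 5, 20000000 * (b : ℝ) ^ m ≤ K * L ^ m := by
    intro m hm
    calc 20000000 * (b : ℝ) ^ m ≤ 20000000 * ((1 + |a|) * L) ^ m := by gcongr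
      _ = 20000000 * (1 + |a|) ^ m * L ^ m := by rw [mul_pow]; ring
      _ ≤ K * L ^ m := mul_le_mul_of_nonneg_right (hKle m hm) (by positivity)
  have hbnd1 := hbnd 1 (by norm_num)
  rw [pow_one, pow_one] at hbnd1
  have hsteps : 2 * Congest.numSteps b ≤ ⌊K * L ^ 2⌋₊ := by
    refine Nat.le_floor (le_trans ?_ (hbnd 2 (by norm_num)))
    have : ((2 * Congest.numSteps b : ℕ) : ℝ) ≤ ((2 * (832 * b ^ 2) : ℕ) : ℝ) := by
      exact_mod_cast Nat.mul_le_mul_left 2 (Congest.numSteps_le hb)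
    refine this.trans ?_
    push_cast
    nlinarith [sq_nonneg (b : ℝ)]
  have hcolors : b + 1 ≤ ⌊K * L⌋₊ := by
    refine Nat.le_floor (le_trans ?_ hbnd1)
    push_cast
    linarith
  rw [hres V net]
  have hdec := Congest.isNetworkDecomposition_finalState net hb
  choose! T hT using Congest.exists_steinerTree net hb
  refine ⟨?_, ⟨hdec.color_eq, fun v => (hdec.color_lt v).trans_le hcolors, hdec.color_ne,
    fun u v h => (hdec.weak_diam u v h).trans (by exact_mod_cast hsteps)⟩, T, fun k hk => ?_, ?_⟩
  -- Since b ≥ 1, a message has at most 6b ≤ 6|a| log n bits, while a chunk carries at least β log n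
  -- bits.
  · have h1 : ((((3 * b + 3) / ⌈β * Real.logb 2 N⌉₊ : ℕ) : ℕ) : ℝ) ≤ 6 * |a| / β := by
      refine Nat.cast_div_le.trans ?_
      have h2 : β * L ≤ (⌈β * Real.logb 2 N⌉₊ : ℝ) :=
        (mul_le_mul_of_nonneg_left hLN hβ.le).trans (Nat.le_ceil _)
      have h3 : 0 < β * L := by positivity
      rw [div_le_div_iff₀ (by linarith) hβ]
      push_cast
      calc (3 * (b : ℝ) + 3) * β ≤ 6 * (|a| * L) * β := by gcongr; linarith
        _ = 6 * |a| * (β * L) := by ring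
        _ ≤ _ := by gcongr
    rw [hrounds]
    have h4 : ((Congest.fullProg b (b + 1)).length : ℝ) ≤ 10000000 * b ^ 5 := by
      exact_mod_cast Congest.fullProg_length_le hb
    push_cast
    calc ((Congest.fullProg b (b + 1)).length : ℝ) *
          ((((3 * b + 3) / ⌈β * Real.logb 2 N⌉₊ : ℕ) : ℝ) + 1 + 1)
        ≤ (10000000 * ((1 + |a|) * L) ^ 5) * (6 * |a| / β + 2) := by
          have h5 : (10000000 * (b : ℝ) ^ 5) ≤ 10000000 * ((1 + |a|) * L) ^ 5 := by gcongr
          exact mul_le_mul (h4.trans h5) (by linarith) (by positivity) (by positivity)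
      _ = K * L ^ 5 := by rw [hK, mul_pow]; ring
  · obtain ⟨h1, h2, r, hr⟩ := hT k hk
    refine ⟨h1, h2, SimpleGraph.radius_le_eccent.trans ((SimpleGraph.eccent_le_iff r _).2 fun v => ?_)⟩
    exact (hr v).trans (by exact_mod_cast (show Congest.numSteps b ≤ _ by omega))
  · intro v j
    have h1 := Congest.ncard_trees_le net hb T (fun k hk => (hT k hk).1) v j
    have h2 : 3 * Congest.numPhases b + 2 ≤ 26 * b := by
      have := Congest.numPhases_le hb
      omega
    have h3 : ((3 * Congest.numPhases b + 2 : ℕ) : ℝ) ≤ 26 * b := by exact_mod_cast h2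
    refine le_trans (by exact_mod_cast h1) (h3.trans ?_)
    linarith
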